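/- Let $\mathbb{S}^2=\hat{\mathbb{C}}=\mathbb{C}\cup\{\infty\}$ be the Riemann sphere with its spherical (great-circle) metric. For a domain (non-empty connected open set) $\Omega\subset\mathbb{S}^2$ let $\mathcal{C}(\Omega)$ be the set of connected components of $\mathbb{S}^2\setminus\Omega$; write $\mathcal{C}_N(\Omega)$ for the components of positive diameter and $\mathcal{C}_P(\Omega)$ for the remaining ones (the point-components). Let $\hat\Omega$ be the quotient space of $\mathbb{S}^2$ obtained by collapsing each $p\in\mathcal{C}(\Omega)$ to a point, with quotient map $\pi_\Omega$. A homeomorphism $f:\Omega\to D$ between domains in $\mathbb{S}^2$ extends to a homeomorphism $\hat f:\hat\Omega\to\hat D$, that is, $\hat f\circ\pi_\Omega=\pi_D\circ f$ on $\Omega$; each $p\in\mathcal{C}(\Omega)$ is identified with the point $\pi_\Omega(p)\in\hat\Omega$. A circle domain is a domain $D\subset\mathbb{S}^2$ such that every $p\in\mathcal{C}_N(D)$ is a closed disk of the sphere. A conformal homeomorphism is a homeomorphism between domains that is holomorphic or anti-holomorphic. **Theorem 1.3.** For every real $\alpha>2$ there is a domain $U_\alpha\subset\mathbb{S}^2$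 such that $\mathcal{C}(U_\alpha)$ is countable, $$\sum_{p\in\mathcal{C}(U_\alpha)}\operatorname{diam}(p)^\alpha<\infty,$$ the closed unit disk $\overline{\mathbb{D}}=\{z\in\mathbb{C}:|z|\le 1\}$ belongs to $\mathcal{C}_N(U_\alpha)$, every other $p\in\mathcal{C}(U_\alpha)$ is a closed subarc $\{re^{i\theta}:a\le\theta\le b\}$, with $r>1$ and $a<b<a+2\pi$, of a circle centred at $0$, and for every conformal homeomorphism $f:U_\alpha\to D$ onto a circle domain $D\subset\mathbb{S}^2$ the extension $\hat f$ satisfies $\hat f(\overline{\mathbb{D}})\in\mathcal{C}_P(D)$. -/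

import Mathlib

/-- The Riemann sphere, as the one-point compactification of the complex plane. -/
abbrev RiemannSphere : Type := OnePoint ℂ

namespace RiemannSphere

noncomputable section

/-- Inverse stereographic projection of the Riemann sphere onto the unit sphere of `ℝ³`;
the point at infinity goes to the north pole. -/
def toSphere : RiemannSphere → EuclideanSpace ℝ (Fin 3)
  | none => !₂[(0 : ℝ), 0, 1]
  | some z => !₂[2 * z.re / (1 + ‖z‖ ^ 2), 2 * z.im / (1 + ‖z‖ ^ 2),
      (‖z‖ ^ 2 - 1) / (1 + ‖z‖ ^ 2)]

/-- The spherical (great circle) distance: the angle between the two points of the unit sphere. -/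
def sphDist (x y : RiemannSphere) : ℝ :=
  InnerProductGeometry.angle (toSphere x) (toSphere y)

/-- The diameter of a set in the spherical distance (the set of distances is bounded by `π`). -/
def sphDiam (A : Set RiemannSphere) : ℝ :=
  sSup {d : ℝ | ∃ x ∈ A, ∃ y ∈ A, d = sphDist x y}

/-- A domain: a (non-empty) connected open set. -/
def IsDomainSet (U : Set RiemannSphere) : Prop :=
  IsOpen U ∧ IsConnected U

/-- The collection `𝒞(U)` of connected components of the complement of `U`. -/
def complComponents (U : Set RiemannSphere) : Set (Set RiemannSphere) :=
  {p | ∃ x ∈ Uᶜ, p = connectedComponentIn Uᶜ x}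

/-- The collection `𝒞_N(U)` of non-trivial complementary components. -/
def nontrivialComponents (U : Set RiemannSphere) : Set (Set RiemannSphere) :=
  {p | p ∈ complComponents U ∧ 0 < sphDiam p}

/-- The collection `𝒞_P(U)` of point-components. -/
def pointComponents (U : Set RiemannSphere) : Set (Set RiemannSphere) :=
  {p | p ∈ complComponents U ∧ ¬ 0 < sphDiam p}

/-- The class `𝓕_α` of `ℓ^α`-domains: countably connected domains whose complementary
components have `α`-summable diameters. -/
def ellDomains (α : ℝ) : Set (Set RiemannSphere) :=
  {U | IsDomainSet U ∧ (complComponents U).Countable ∧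
    Summable fun p : complComponents U => sphDiam (p : Set RiemannSphere) ^ α}

/-- A closed disk of the sphere, i.e. a closed ball of the spherical distance. -/
def IsClosedDisk (p : Set RiemannSphere) : Prop :=
  ∃ (c : RiemannSphere) (r : ℝ), 0 < r ∧ r < Real.pi ∧ p = {x | sphDist x c ≤ r}

/-- A circle domain: a domain all of whose non-trivial complementary components are disks. -/
def IsCircleDomain (D : Set RiemannSphere) : Prop :=
  IsDomainSet D ∧ ∀ p ∈ nontrivialComponents D, IsClosedDisk p

/-- The closed unit disk `{|z| ≤ 1}` as a subset of the sphere. -/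
def closedUnitDisk : Set RiemannSphere :=
  (fun z : ℂ => (z : RiemannSphere)) '' Metric.closedBall (0 : ℂ) 1

/-- A closed proper subarc, with more than one point, of the circle of radius `r` about `0`. -/
def IsCircularArc (r : ℝ) (p : Set RiemannSphere) : Prop :=
  ∃ a b : ℝ, a < b ∧ b < a + 2 * Real.pi ∧
    p = (fun θ : ℝ => (((r : ℂ) * Complex.exp (θ * Complex.I) : ℂ) : RiemannSphere)) '' Set.Icc a b

theorem eq_of_mem_complComponents {U : Set RiemannSphere} {p q : Set RiemannSphere}
    (hp : p ∈ complComponents U) (hq : q ∈ complComponents U) {y : RiemannSphere}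
    (hyp : y ∈ p) (hyq : y ∈ q) : p = q := by
  obtain ⟨x, _, rfl⟩ := hp
  obtain ⟨x', _, rfl⟩ := hq
  rw [connectedComponentIn_eq hyp, connectedComponentIn_eq hyq]

/-- The equivalence relation that collapses each complementary component of `U` to a point. -/
def collapse (U : Set RiemannSphere) : Setoid RiemannSphere where
  r x y := x = y ∨ ∃ p ∈ complComponents U, x ∈ p ∧ y ∈ p
  iseqv :=
    { refl := fun _ => Or.inl rfl
      symm := by
        rintro x y (rfl | ⟨p, hp, hx, hy⟩)
        · exact Or.inl rfl
        · exact Or.inr ⟨p, hp, hy, hx⟩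
      trans := by
        rintro x y z (rfl | ⟨p, hp, hx, hy⟩) (rfl | ⟨q, hq, hy', hz⟩)
        · exact Or.inl rfl
        · exact Or.inr ⟨q, hq, hy', hz⟩
        · exact Or.inr ⟨p, hp, hx, hy⟩
        · have h := eq_of_mem_complComponents hp hq hy hy'
          exact Or.inr ⟨p, hp, hx, h ▸ hz⟩ }

/-- The decomposition space `Û`, with the quotient topology. -/
abbrev Hat (U : Set RiemannSphere) : Type := Quotient (collapse U)

/-- The quotient map `π_U` from the sphere to `Û`. -/
def proj (U : Set RiemannSphere) (x : RiemannSphere) : Hat U := Quotient.mk (collapse U) x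

/-- The standard local coordinate of the Riemann sphere around `a`: the identity if `a` is
finite, and `x ↦ 1 / x` if `a = ∞`. (The value at the one point outside the domain of the
coordinate plays no role.) -/
def coordAt : RiemannSphere → RiemannSphere → ℂ
  | some _, some x => x
  | some _, none => 0
  | none, some x => x⁻¹
  | none, none => 0

open Classical in
/-- The inverse of the local coordinate around `a`. -/
def paramAt : RiemannSphere → ℂ → RiemannSphere
  | some _, w => (w : RiemannSphere)
  | none, w => if w = 0 then OnePoint.infty else ((w⁻¹ : ℂ) : RiemannSphere)

/-- `f` is holomorphic near `a`, as a map between Riemann surfaces. -/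
def HolomorphicAt (f : RiemannSphere → RiemannSphere) (a : RiemannSphere) : Prop :=
  ContinuousAt f a ∧
    AnalyticAt ℂ (fun w : ℂ => coordAt (f a) (f (paramAt a w))) (coordAt a a)

/-- Complex conjugation on the Riemann sphere, fixing `∞`. -/
def conj : RiemannSphere → RiemannSphere := OnePoint.map (starRingEnd ℂ)

/-- A homeomorphism `f` from the open set `f.source` onto the open set `f.target` is conformal
(angle preserving, of either orientation) if it is holomorphic or anti-holomorphic. -/
def IsConformal (f : OpenPartialHomeomorph RiemannSphere RiemannSphere) : Prop :=
  (∀ x ∈ f.source, HolomorphicAt f x) ∨ (∀ x ∈ f.source, HolomorphicAt (conj ∘ f) x)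

/-- The homeomorphism `F : Û → D̂` extends the homeomorphism `f` of `U = f.source` onto
`D = f.target`. -/
def Extends (f : OpenPartialHomeomorph RiemannSphere RiemannSphere)
    (F : Hat f.source ≃ₜ Hat f.target) : Prop :=
  ∀ x ∈ f.source, F (proj f.source x) = proj f.target (f x)

end

end RiemannSphere

/-! The domain is one and the same for all `α`. Around the closed unit disk, on the circles of
radius `exp (1 / (j + 1))`, lie rings of `j + 1` equal arcs separated by very narrow gaps. An arc of
the `j`-th ring has diameter `O(1 / (j + 1))`, so the `α`-sum is dominated by `∑ (j + 1) ^ (1 - α)`,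
which converges exactly for `α > 2`.

Let `f` map the domain conformally onto a circle domain. After a Möbius map, `f` fixes `∞` and the
arcs correspond to disjoint Euclidean disks, possibly points, of radii `r j k` inside a compact set.
Comparing areas gives `∑ r j k ^ 2 < ∞`. Around each gap of ring `j` there is a family of
half-circular crosscuts joining the two neighbouring arcs; in logarithmic coordinates it is a
rectangle of width `(j + 1) ^ 4` and height `π`. By the length-area principle
(`exists_short_crosscut`) some crosscut of the family has an image of diameter `O(1 / (j + 1) ^ 2)`,
so the chosen crosscuts of the ring contribute `O(1 / (j + 1))` altogether.

The arcs of the ring and these crosscuts separate the unit disk from `∞` (`exists_separation`).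
Their images form a chain of bounded size, and the set corresponding to the disk cannot lie outside
a ball that contains the chain. If two of its points are at distance `d`, then `d ≤ 4 * ∑ k, r j k +
C / (j + 1)` for every `j`. By Cauchy–Schwarz, `∑ k, r j k ^ 2` is eventually at least a constant
times `1 / (j + 1)`. The harmonic series diverges, which contradicts the finite area unless the unit
disk corresponds to a point.

Speaking of what the disk corresponds to requires the homeomorphism of decomposition spaces that
extends `f`. It rests on the unicoherence of the sphere: a complementary component has arbitrarily
small saturated neighbourhoods whose trace on the domain is connected (`exists_saturated_nhd`).
Cluster sets at a component are then connected and lie in a single component of the target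
(`exists_cluster_component`). -/

open Set Filter Topology MeasureTheory

/-! ### Logarithms of circle-valued maps and unicoherence of the sphere. -/

/-- Every continuous map from the Riemann sphere to the circle has a continuous logarithm. -/
theorem OnePoint.exists_circle_lift (φ : C(OnePoint ℂ, Circle)) :
    ∃ H : C(OnePoint ℂ, ℝ), ∀ x, Circle.exp (H x) = φ x := by
  obtain ⟨e, he⟩ := Circle.exp_surjective (φ ((0 : ℂ) : OnePoint ℂ))
  obtain ⟨h, ⟨-, hh⟩, -⟩ := Circle.isCoveringMap_exp.existsUnique_continuousMap_lifts
    (φ.comp ⟨((↑) : ℂ → OnePoint ℂ), OnePoint.continuous_coe⟩) (0 : ℂ) e (by simpa using he)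
  have hexp : ∀ z : ℂ, Circle.exp (h z) = φ z := fun z => congrFun hh z
  obtain ⟨t, ht⟩ := Circle.exp_surjective (φ OnePoint.infty)
  obtain ⟨σ, hσt, hσ⟩ := isLocalHomeomorph_circleExp t
  have hN : ∀ᶠ x in 𝓝 (OnePoint.infty : OnePoint ℂ), φ x ∈ σ.target := by
    refine φ.continuous.continuousAt.eventually (σ.open_target.mem_nhds ?_)
    rw [← ht, hσ]
    exact σ.map_source hσt
  have hθ : ∀ x, φ x ∈ σ.target → Circle.exp (σ.symm (φ x)) = φ x := by
    intro x hx
    rw [hσ]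
    exact σ.right_inv hx
  have hN' := hN
  rw [OnePoint.nhds_infty_eq, eventually_sup, eventually_map, coclosedCompact_eq_cocompact,
    Metric.cobounded_eq_cocompact.symm, (hasBasis_cobounded_norm (E := ℂ)).eventually_iff] at hN'
  obtain ⟨⟨R, -, hR⟩, -⟩ := hN'
  -- The exterior of a disk is the exponential of a half-plane, hence connected; `max R 1` keeps it
  -- away from `0`.
  set S : Set ℂ := (fun w : ℂ => Complex.exp w) '' {w | max R 1 ≤ Real.exp w.re} with hS
  have hSR : ∀ z : ℂ, z ∈ S ↔ max R 1 ≤ ‖z‖ := by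
    intro z
    constructor
    · rintro ⟨w, hw, rfl⟩
      rw [Complex.norm_exp]
      exact hw
    · intro hz
      have h0 : z ≠ 0 := by
        rintro rfl
        have := (le_max_right R 1).trans hz
        simp at this
        linarith
      refine ⟨Complex.log z, ?_, Complex.exp_log h0⟩
      change max R 1 ≤ Real.exp (Complex.log z).re
      rw [← Complex.norm_exp, Complex.exp_log h0]
      exact hz
  have hSc : IsPreconnected S := by
    refine IsPreconnected.image ?_ _ Complex.continuous_exp.continuousOn
    have : {w : ℂ | max R 1 ≤ Real.exp w.re} = Complex.reLm ⁻¹' {x | max R 1 ≤ Real.exp x} := rfl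
    rw [this]
    refine Convex.isPreconnected (Convex.linear_preimage (OrdConnected.convex ?_) _)
    exact ⟨fun x hx y _ z hz => le_trans hx (Real.exp_le_exp.2 hz.1)⟩
  have hST : ∀ z ∈ S, φ (z : OnePoint ℂ) ∈ σ.target := fun z hz =>
    hR ((le_max_left R 1).trans ((hSR z).1 hz))
  set z₀ : ℂ := ((max R 1 : ℝ) : ℂ) with hz₀
  have hz₀S : z₀ ∈ S := by
    rw [hSR, hz₀, Complex.norm_real]
    exact le_abs_self _
  set c : ℝ := h z₀ - σ.symm (φ z₀) with hc
  -- Near `∞` the lift over the plane and the local logarithm are two lifts of `φ`, up to the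
  -- constant `c ∈ 2πℤ`. Agreement at `z₀` propagates over the connected set `S`.
  have hEq : EqOn h (fun z => σ.symm (φ z) + c) S := by
    refine Circle.isCoveringMap_exp.eqOn_of_comp_eqOn hSc h.continuous.continuousOn ?_ ?_ hz₀S ?_
    · refine ContinuousOn.add ?_ continuousOn_const
      refine σ.continuousOn_symm.comp ?_ hST
      exact (φ.continuous.comp OnePoint.continuous_coe).continuousOn
    · intro z hz
      have h1 : Circle.exp c = 1 := by
        rw [hc, Circle.exp_sub, hexp, hθ _ (hST _ hz₀S), div_self']
      simp only [Function.comp_apply]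
      rw [Circle.exp_add, h1, hθ _ (hST _ hz), hexp, mul_one]
    · simp [hc]
  refine ⟨OnePoint.continuousMapMk h (σ.symm (φ OnePoint.infty) + c) ?_, ?_⟩
  · have hlim : Tendsto (fun z : ℂ => σ.symm (φ z) + c) (coclosedCompact ℂ)
        (𝓝 (σ.symm (φ OnePoint.infty) + c)) := by
      refine Tendsto.add_const c ?_
      have h1 : ContinuousAt σ.symm (φ OnePoint.infty) :=
        σ.continuousAt_symm hN.self_of_nhds
      have h2 : Tendsto (fun z : ℂ => φ (z : OnePoint ℂ)) (coclosedCompact ℂ)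
          (𝓝 (φ OnePoint.infty)) :=
        (φ.continuous.tendsto _).comp OnePoint.tendsto_coe_infty
      exact h1.tendsto.comp h2
    refine hlim.congr' ?_
    rw [coclosedCompact_eq_cocompact, Metric.cobounded_eq_cocompact.symm]
    filter_upwards [(hasBasis_cobounded_norm (E := ℂ)).mem_of_mem (i := max R 1) trivial] with z hz
    exact (hEq ((hSR z).2 hz)).symm
  · intro x
    induction x using OnePoint.rec with
    | infty =>
      have h1 : Circle.exp c = 1 := by
        rw [hc, Circle.exp_sub, hexp, hθ _ (hST _ hz₀S), div_self']
      change Circle.exp (σ.symm (φ OnePoint.infty) + c) = _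
      rw [Circle.exp_add, h1, hθ _ hN.self_of_nhds, mul_one]
    | coe z => exact hexp z

/-- A normal space on which circle-valued maps have logarithms is unicoherent for open sets. -/
theorem isPreconnected_inter_of_circle_lift {X : Type*} [TopologicalSpace X] [NormalSpace X]
    (hX : ∀ φ : C(X, Circle), ∃ H : C(X, ℝ), ∀ x, Circle.exp (H x) = φ x)
    {A B : Set X} (hA : IsOpen A) (hB : IsOpen B) (hAc : IsPreconnected A)
    (hBc : IsPreconnected B) (hAB : A ∪ B = univ) : IsPreconnected (A ∩ B) := by
  classical
  rw [isPreconnected_iff_subset_of_disjoint]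
  intro P' Q' hP' hQ' hcov hdis
  by_contra hcon
  rw [not_or, not_subset, not_subset] at hcon
  obtain ⟨⟨q, hqAB, hqP'⟩, ⟨p, hpAB, hpQ'⟩⟩ := hcon
  set P := A ∩ B ∩ P' with hP
  have hPo : IsOpen P := (hA.inter hB).inter hP'
  have hp : p ∈ P := ⟨hpAB, (hcov hpAB).resolve_right hpQ'⟩
  have hq : q ∉ P := fun h => hqP' h.2
  -- `P` is relatively clopen in `A ∩ B`, so its frontier points in `A` lie off `B`, and conversely.
  have hfr : ∀ x ∈ frontier P, x ∉ A ∩ B := by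
    intro x hx hxAB
    have hxP : x ∉ P := fun h => by
      rw [hPo.frontier_eq] at hx
      exact hx.2 h
    have hxQ : x ∈ A ∩ B ∩ Q' :=
      ⟨hxAB, (hcov hxAB).resolve_left fun h => hxP ⟨hxAB, h⟩⟩
    obtain ⟨y, hy1, hy2⟩ := mem_closure_iff.1 (frontier_subset_closure hx) _
      ((hA.inter hB).inter hQ') hxQ
    have : y ∈ A ∩ B ∩ (P' ∩ Q') := ⟨hy1.1, hy2.2, hy1.2⟩
    rw [hdis] at this
    exact this
  obtain ⟨u, hu0, hu1, -⟩ := exists_continuous_zero_one_of_isClosed hA.isClosed_compl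
    hB.isClosed_compl (by
      rw [disjoint_iff_inter_eq_empty, ← compl_union, hAB, compl_univ])
  -- The two functions differ by `2π` on `P` and agree elsewhere, so they define one circle-valued
  -- map. The Urysohn function `u` makes each of them continuous on its own open set, although not
  -- on the whole space.
  set kA : X → ℝ := P.piecewise (fun x => 2 * Real.pi * (u x - 1)) 0 with hkA
  set kB : X → ℝ := P.piecewise (fun x => 2 * Real.pi * u x) 0 with hkB
  have hkAc : ContinuousOn kA A := by
    refine ContinuousOn.piecewise ?_ (by fun_prop) (by fun_prop)
    rintro x ⟨hxA, hx⟩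
    have : x ∈ Bᶜ := fun h => hfr x hx ⟨hxA, h⟩
    simp [hu1 this]
  have hkBc : ContinuousOn kB B := by
    refine ContinuousOn.piecewise ?_ (by fun_prop) (by fun_prop)
    rintro x ⟨hxB, hx⟩
    have : x ∈ Aᶜ := fun h => hfr x hx ⟨h, hxB⟩
    simp [hu0 this]
  have hexp : ∀ x, Circle.exp (kA x) = Circle.exp (kB x) := by
    intro x
    by_cases hx : x ∈ P
    · simp only [hkA, hkB, piecewise_eq_of_mem _ _ _ hx]
      rw [Circle.exp_eq_exp]
      exact ⟨-1, by push_cast; ring⟩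
    · simp only [hkA, hkB, piecewise_eq_of_notMem _ _ _ hx]
  have hcont : Continuous fun x => Circle.exp (kA x) := by
    rw [← continuousOn_univ, ← hAB]
    refine ContinuousOn.union_of_isOpen ?_ ?_ hA hB
    · exact Circle.exp.continuous.comp_continuousOn hkAc
    · exact (Circle.exp.continuous.comp_continuousOn hkBc).congr fun x _ => hexp x
  obtain ⟨H, hH⟩ := hX ⟨_, hcont⟩
  have key : ∀ (S : Set X) (k : X → ℝ), IsPreconnected S → ContinuousOn k S → p ∈ S → q ∈ S →
      (∀ x, Circle.exp (k x) = Circle.exp (H x)) → H q = k q + (H p - k p) := by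
    intro S k hS hk hpS hqS hkH
    refine Circle.isCoveringMap_exp.eqOn_of_comp_eqOn (g₂ := fun x => k x + (H p - k p)) hS
      H.continuous.continuousOn (hk.add continuousOn_const) ?_ hpS ?_ hqS
    · intro x _
      simp only [Function.comp_apply]
      rw [Circle.exp_add, Circle.exp_sub, hkH, hkH, div_self', mul_one]
    · simp
  -- The increment of `H` from `p` to `q` is computed once through `A` and once through `B`; the two
  -- answers differ by `2π`.
  have h1 := key A kA hAc hkAc hpAB.1 hqAB.1 fun x => (hH x).symm
  have h2 := key B kB hBc hkBc hpAB.2 hqAB.2 fun x => (hexp x).symm.trans (hH x).symm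
  simp only [hkA, hkB, piecewise_eq_of_mem _ _ _ hp, piecewise_eq_of_notMem _ _ _ hq] at h1 h2
  have := Real.pi_pos
  simp at h1 h2
  linarith

theorem OnePoint.isPreconnected_inter_of_union_eq_univ {A B : Set (OnePoint ℂ)} (hA : IsOpen A)
    (hB : IsOpen B) (hAc : IsPreconnected A) (hBc : IsPreconnected B) (hAB : A ∪ B = univ) :
    IsPreconnected (A ∩ B) :=
  isPreconnected_inter_of_circle_lift OnePoint.exists_circle_lift hA hB hAc hBc hAB

instance OnePoint.locallyConnectedSpace_complex : LocallyConnectedSpace (OnePoint ℂ) := by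
  have e : OnePoint ℂ ≃ₜ Metric.sphere (0 : EuclideanSpace ℝ (Fin 3)) 1 :=
    onePointEquivSphereOfFinrankEq (by simp)
  have : Fact (Module.finrank ℝ (EuclideanSpace ℝ (Fin 3)) = 2 + 1) := ⟨by simp⟩
  have : LocallyConnectedSpace (Metric.sphere (0 : EuclideanSpace ℝ (Fin 3)) 1) :=
    ChartedSpace.locallyConnectedSpace (EuclideanSpace ℝ (Fin 2)) _
  exact e.isOpenEmbedding.locallyConnectedSpace

theorem IsPreconnected.subset_left_of_isClosed {X : Type*} [TopologicalSpace X] {s u v : Set X}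
    (hs : IsPreconnected s) (hu : IsClosed u) (hv : IsClosed v) (huv : Disjoint u v)
    (hsuv : s ⊆ u ∪ v) (hsu : (s ∩ u).Nonempty) : s ⊆ u := by
  refine Disjoint.subset_left_of_subset_union hsuv ?_
  rw [disjoint_iff_inter_eq_empty, ← not_nonempty_iff_eq_empty]
  intro hsv
  obtain ⟨x, -, hxu, hxv⟩ := isPreconnected_closed_iff.1 hs u v hu hv hsuv hsu hsv
  exact disjoint_left.1 huv hxu hxv

/-- By compactness, disjoint open sets that separate the intersection already cover, and hence
separate, some member of the family. -/
theorem isPreconnected_iInter_of_directed {X ι : Type*} [TopologicalSpace X] [T2Space X]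
    [CompactSpace X] [Nonempty ι] (s : ι → Set X) (hd : Directed (· ⊇ ·) s)
    (hcl : ∀ i, IsClosed (s i)) (hpre : ∀ i, IsPreconnected (s i)) :
    IsPreconnected (⋂ i, s i) := by
  rw [isPreconnected_closed_iff]
  intro t t' ht ht' htt ⟨a, haC, hat⟩ ⟨b, hbC, hbt⟩
  by_contra hne
  rw [not_nonempty_iff_eq_empty] at hne
  have hC : IsClosed (⋂ i, s i) := isClosed_iInter hcl
  have hdisj : Disjoint ((⋂ i, s i) ∩ t) ((⋂ i, s i) ∩ t') := by
    rw [disjoint_iff_inter_eq_empty, ← inter_inter_distrib_left, hne]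
  obtain ⟨O₁, O₂, hO₁, hO₂, h₁, h₂, hO⟩ :=
    normal_separation (hC.inter ht) (hC.inter ht') hdisj
  obtain ⟨i, hi⟩ := exists_subset_nhds_of_compactSpace hd hcl (U := O₁ ∪ O₂) (by
    intro x hx
    refine (hO₁.union hO₂).mem_nhds ?_
    rcases htt hx with h | h
    · exact Or.inl (h₁ ⟨hx, h⟩)
    · exact Or.inr (h₂ ⟨hx, h⟩))
  have hsub := (hpre i).subset_left_of_subset_union hO₁ hO₂ hO hi
    ⟨a, mem_iInter.1 haC i, h₁ ⟨haC, hat⟩⟩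
  exact disjoint_left.1 hO (hsub (mem_iInter.1 hbC i)) (h₂ ⟨hbC, hbt⟩)

/-! ### Decomposition spaces and the extension of homeomorphisms to them. -/

namespace RiemannSphere

/-- A set is saturated if it contains every complementary component of `U` that it meets. -/
def IsSaturated (U V : Set RiemannSphere) : Prop :=
  ∀ p ∈ complComponents U, (p ∩ V).Nonempty → p ⊆ V

theorem isPreconnected_of_mem_complComponents {U p : Set RiemannSphere}
    (hp : p ∈ complComponents U) : IsPreconnected p := by
  obtain ⟨x, _, rfl⟩ := hp
  exact isPreconnected_connectedComponentIn

theorem subset_compl_of_mem_complComponents {U p : Set RiemannSphere}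
    (hp : p ∈ complComponents U) : p ⊆ Uᶜ := by
  obtain ⟨x, _, rfl⟩ := hp
  exact connectedComponentIn_subset _ _

theorem nonempty_of_mem_complComponents {U p : Set RiemannSphere}
    (hp : p ∈ complComponents U) : p.Nonempty := by
  obtain ⟨x, hx, rfl⟩ := hp
  exact ⟨x, mem_connectedComponentIn hx⟩

theorem eq_connectedComponentIn_of_mem {U p : Set RiemannSphere} {x : RiemannSphere}
    (hp : p ∈ complComponents U) (hx : x ∈ p) : p = connectedComponentIn Uᶜ x := by
  obtain ⟨y, _, rfl⟩ := hp
  exact connectedComponentIn_eq hx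

theorem subset_of_isPreconnected_of_mem {U p S : Set RiemannSphere} {x : RiemannSphere}
    (hp : p ∈ complComponents U) (hx : x ∈ p) (hS : IsPreconnected S) (hxS : x ∈ S)
    (hSU : S ⊆ Uᶜ) : S ⊆ p := by
  rw [eq_connectedComponentIn_of_mem hp hx]
  exact hS.subset_connectedComponentIn hxS hSU

theorem isClosed_of_mem_complComponents {U p : Set RiemannSphere} (hU : IsOpen U)
    (hp : p ∈ complComponents U) : IsClosed p := by
  obtain ⟨x, hx⟩ := nonempty_of_mem_complComponents hp
  refine isClosed_of_closure_subset ?_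
  refine subset_of_isPreconnected_of_mem hp hx (isPreconnected_of_mem_complComponents hp).closure
    (subset_closure hx) ?_
  exact closure_minimal (subset_compl_of_mem_complComponents hp) hU.isClosed_compl

/-- In the compact Hausdorff space `Uᶜ` a component is the intersection of the clopen sets
containing it, and by compactness one of these already fits into `W`. -/
theorem exists_closed_partition {U p W : Set RiemannSphere} (hU : IsOpen U)
    (hp : p ∈ complComponents U) (hW : IsOpen W) (hpW : p ⊆ W) :
    ∃ K K' : Set RiemannSphere, IsClosed K ∧ IsClosed K' ∧ Disjoint K K' ∧ K ∪ K' = Uᶜ ∧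
      p ⊆ K ∧ K ⊆ W := by
  obtain ⟨x, hx, rfl⟩ := hp
  have : CompactSpace ↥(Uᶜ) := isCompact_iff_compactSpace.1 hU.isClosed_compl.isCompact
  rw [connectedComponentIn_eq_image hx, connectedComponent_eq_iInter_isClopen] at hpW
  have : Nonempty { s : Set ↥(Uᶜ) // IsClopen s ∧ (⟨x, hx⟩ : ↥(Uᶜ)) ∈ s } :=
    ⟨⟨univ, isClopen_univ, mem_univ _⟩⟩
  obtain ⟨s, hs⟩ := exists_subset_nhds_of_compactSpace
    (V := fun s : { s : Set ↥(Uᶜ) // IsClopen s ∧ (⟨x, hx⟩ : ↥(Uᶜ)) ∈ s } => (s : Set ↥(Uᶜ)))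
    (hV := by
      intro a b
      exact ⟨⟨a ∩ b, a.2.1.inter b.2.1, a.2.2, b.2.2⟩, inter_subset_left, inter_subset_right⟩)
    (fun s => s.2.1.isClosed) (U := (↑) ⁻¹' W) (by
      intro y hy
      exact (hW.preimage continuous_subtype_val).mem_nhds (hpW ⟨y, hy, rfl⟩))
  have hemb := hU.isClosed_compl.isClosedEmbedding_subtypeVal
  refine ⟨(↑) '' (s : Set ↥(Uᶜ)), (↑) '' (s : Set ↥(Uᶜ))ᶜ, hemb.isClosedMap _ s.2.1.isClosed,
    hemb.isClosedMap _ s.2.1.compl.isClosed, ?_, ?_, ?_, ?_⟩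
  · exact (disjoint_image_iff Subtype.val_injective).2 disjoint_compl_right
  · rw [← image_union, union_compl_self, image_univ, Subtype.range_coe]
  · rw [connectedComponentIn_eq_image hx]
    exact image_mono (s.2.1.connectedComponent_subset s.2.2)
  · rintro _ ⟨y, hy, rfl⟩
    exact hs hy

/-- Complementary components of a domain have small saturated neighbourhoods which meet the
domain in a connected set. -/
theorem exists_saturated_nhd {U p W : Set RiemannSphere} (hU : IsDomainSet U)
    (hp : p ∈ complComponents U) (hW : IsOpen W) (hpW : p ⊆ W) :
    ∃ V, IsOpen V ∧ p ⊆ V ∧ V ⊆ W ∧ IsSaturated U V ∧ IsConnected (V ∩ U) := by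
  obtain ⟨K, K', hK, hK', hdis, hKK, hpK, hKW⟩ := exists_closed_partition hU.1 hp hW hpW
  obtain ⟨x, hx⟩ := nonempty_of_mem_complComponents hp
  set W₁ := W \ K' with hW₁
  have hW₁o : IsOpen W₁ := hW.sdiff hK'
  have hKW₁ : K ⊆ W₁ := fun y hy => ⟨hKW hy, disjoint_left.1 hdis hy⟩
  have hW₁K : ∀ y ∈ W₁, y ∈ Uᶜ → y ∈ K := by
    intro y hy hyU
    rw [← hKK] at hyU
    exact hyU.resolve_right hy.2
  set V := connectedComponentIn W₁ x with hV
  have hVo : IsOpen V := hW₁o.connectedComponentIn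
  have hVW₁ : V ⊆ W₁ := connectedComponentIn_subset _ _
  have hxV : x ∈ V := mem_connectedComponentIn (hKW₁ (hpK hx))
  have hsat : IsSaturated U V := by
    rintro q hq ⟨y, hyq, hyV⟩
    have hqU := subset_compl_of_mem_complComponents hq
    have hqK : q ⊆ K := by
      refine (isPreconnected_of_mem_complComponents hq).subset_left_of_isClosed hK hK' hdis ?_ ?_
      · rwa [hKK]
      · exact ⟨y, hyq, hW₁K y (hVW₁ hyV) (hqU hyq)⟩
    have := (isPreconnected_of_mem_complComponents hq).subset_connectedComponentIn hyq
      (hqK.trans hKW₁)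
    rwa [← connectedComponentIn_eq hyV] at this
  refine ⟨V, hVo, hsat p hp ⟨x, hx, hxV⟩, hVW₁.trans sdiff_subset, hsat, ?_⟩
  have hVK : V ∩ K = V ∩ Uᶜ := by
    ext y
    refine and_congr_right fun hy => ⟨fun h => ?_, fun h => hW₁K y (hVW₁ hy) h⟩
    rw [← hKK]
    exact Or.inl h
  -- `V ∩ Uᶜ` equals `V ∩ K`. A point of `K` outside `V` belongs to another component of the open
  -- set `W₁`, which is a neighbourhood disjoint from `V`.
  have hVUcl : IsClosed (V ∩ Uᶜ) := by
    rw [← isOpen_compl_iff, isOpen_iff_mem_nhds]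
    intro y hy
    by_cases hyK : y ∈ K
    · have hyV : y ∉ V := fun h => hy (hVK ▸ ⟨h, hyK⟩)
      refine mem_of_superset (connectedComponentIn_mem_nhds (hW₁o.mem_nhds (hKW₁ hyK))) ?_
      intro z hz hzV
      apply hyV
      rw [hV, connectedComponentIn_eq hzV.1, ← connectedComponentIn_eq hz]
      exact mem_connectedComponentIn (hKW₁ hyK)
    · refine mem_of_superset (hK.isOpen_compl.mem_nhds hyK) ?_
      intro z hz hzV
      rw [← hVK] at hzV
      exact hz hzV.2
  set A := (V ∩ Uᶜ)ᶜ with hA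
  have hUA : U ⊆ A := fun y hy h => h.2 hy
  obtain ⟨u₀, hu₀⟩ := hU.2.1
  -- A component of `A` missing `U` would lie in the closed set `Vᶜ ∩ Uᶜ ⊆ A`. It would then be
  -- clopen in the connected sphere.
  have hAcomp : ∀ y ∈ A, (connectedComponentIn A y ∩ U).Nonempty := by
    intro y hy
    by_contra hne
    rw [not_nonempty_iff_eq_empty] at hne
    have hsub : connectedComponentIn A y ⊆ Vᶜ ∩ Uᶜ := by
      intro z hz
      have hzU : z ∈ Uᶜ := fun h => by
        have : z ∈ connectedComponentIn A y ∩ U := ⟨hz, h⟩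
        rwa [hne] at this
      exact ⟨fun h => (connectedComponentIn_subset A y hz) ⟨h, hzU⟩, hzU⟩
    have hcl : closure (connectedComponentIn A y) ⊆ Vᶜ ∩ Uᶜ :=
      closure_minimal hsub (hVo.isClosed_compl.inter hU.1.isClosed_compl)
    have hcl' : closure (connectedComponentIn A y) ⊆ connectedComponentIn A y :=
      isPreconnected_connectedComponentIn.closure.subset_connectedComponentIn
        (subset_closure (mem_connectedComponentIn hy)) (fun z hz h => (hcl hz).1 h.1)
    have hclopen : IsClopen (connectedComponentIn A y) :=
      ⟨isClosed_of_closure_subset hcl', hVUcl.isOpen_compl.connectedComponentIn⟩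
    rcases isClopen_iff.1 hclopen with h | h
    · exact (h ▸ mem_connectedComponentIn hy : y ∈ (∅ : Set RiemannSphere))
    · have : u₀ ∈ connectedComponentIn A y := h ▸ mem_univ u₀
      exact (hsub this).2 hu₀
  have hApre : IsPreconnected A := by
    refine isPreconnected_of_forall u₀ fun y hy => ?_
    obtain ⟨z, hz, hzU⟩ := hAcomp y hy
    exact ⟨connectedComponentIn A y ∪ U, union_subset (connectedComponentIn_subset _ _) hUA,
      Or.inr hu₀, Or.inl (mem_connectedComponentIn hy),
      isPreconnected_connectedComponentIn.union z hz hzU hU.2.isPreconnected⟩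
  have hAV : A ∪ V = univ := by
    rw [eq_univ_iff_forall]
    intro y
    by_cases hy : y ∈ V
    · exact Or.inr hy
    · exact Or.inl fun h => hy h.1
  have hint : A ∩ V = V ∩ U := by
    ext y
    constructor
    · rintro ⟨h1, h2⟩
      exact ⟨h2, by_contra fun h => h1 ⟨h2, h⟩⟩
    · rintro ⟨h1, h2⟩
      exact ⟨hUA h2, h1⟩
  refine ⟨?_, ?_⟩
  · by_contra hne
    rw [not_nonempty_iff_eq_empty] at hne
    have hVU : V ∩ Uᶜ = V := inter_eq_left.2 fun y hy h =>
      (hne ▸ (⟨hy, h⟩ : y ∈ V ∩ U) : y ∈ (∅ : Set RiemannSphere))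
    rcases isClopen_iff.1 (⟨hVU ▸ hVUcl, hVo⟩ : IsClopen V) with h | h
    · exact (h ▸ hxV : x ∈ (∅ : Set RiemannSphere))
    · have : u₀ ∈ V ∩ U := ⟨h ▸ mem_univ u₀, hu₀⟩
      rw [hne] at this
      exact this
  -- `A` and `V` are open, connected and cover the sphere, so unicoherence applies to `A ∩ V = V ∩
  -- U`.
  · rw [← hint]
    exact OnePoint.isPreconnected_inter_of_union_eq_univ hVUcl.isOpen_compl hVo hApre
      isPreconnected_connectedComponentIn hAV

theorem mk_mem_complComponents {U : Set RiemannSphere} {x : RiemannSphere} (hx : x ∉ U) :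
    connectedComponentIn Uᶜ x ∈ complComponents U := ⟨x, hx, rfl⟩

theorem proj_eq_proj_iff {U : Set RiemannSphere} {x y : RiemannSphere} :
    proj U x = proj U y ↔ x = y ∨ ∃ p ∈ complComponents U, x ∈ p ∧ y ∈ p :=
  Quotient.eq (r := collapse U)

theorem proj_eq_of_mem {U p : Set RiemannSphere} {x y : RiemannSphere}
    (hp : p ∈ complComponents U) (hx : x ∈ p) (hy : y ∈ p) : proj U x = proj U y :=
  proj_eq_proj_iff.2 (Or.inr ⟨p, hp, hx, hy⟩)

theorem proj_eq_iff_of_mem {U : Set RiemannSphere} {x y : RiemannSphere} (hx : x ∈ U) :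
    proj U x = proj U y ↔ x = y := by
  rw [proj_eq_proj_iff]
  refine ⟨?_, Or.inl⟩
  rintro (h | ⟨p, hp, hxp, _⟩)
  · exact h
  · exact absurd hx (subset_compl_of_mem_complComponents hp hxp)

theorem proj_eq_iff_mem {U p : Set RiemannSphere} {x y : RiemannSphere}
    (hp : p ∈ complComponents U) (hx : x ∈ p) : proj U y = proj U x ↔ y ∈ p := by
  rw [proj_eq_proj_iff]
  constructor
  · rintro (rfl | ⟨q, hq, hyq, hxq⟩)
    · exact hx
    · rwa [eq_of_mem_complComponents hp hq hx hxq]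
  · exact fun h => Or.inr ⟨p, hp, h, hx⟩

theorem continuous_proj (U : Set RiemannSphere) : Continuous (proj U) := continuous_quot_mk

theorem surjective_proj (U : Set RiemannSphere) : Function.Surjective (proj U) := Quot.mk_surjective

theorem IsSaturated.proj_mem_image_iff {U V : Set RiemannSphere} (hV : IsSaturated U V)
    {x : RiemannSphere} : proj U x ∈ proj U '' V ↔ x ∈ V := by
  refine ⟨?_, fun h => ⟨x, h, rfl⟩⟩
  rintro ⟨y, hy, hyx⟩
  rcases proj_eq_proj_iff.1 hyx with rfl | ⟨p, hp, hyp, hxp⟩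
  · exact hy
  · exact hV p hp ⟨y, hyp, hy⟩ hxp

theorem IsSaturated.isOpen_image_proj {U V : Set RiemannSphere} (hV : IsSaturated U V)
    (hVo : IsOpen V) : IsOpen (proj U '' V) := by
  have : IsOpen (proj U ⁻¹' (proj U '' V)) := by
    convert! hVo using 1
    ext x
    exact hV.proj_mem_image_iff
  exact this

theorem exists_saturated_nhd_of_class {U W : Set RiemannSphere} (hU : IsDomainSet U)
    (x : RiemannSphere) (hW : IsOpen W) (hxW : ∀ y, proj U y = proj U x → y ∈ W) :
    ∃ V, IsOpen V ∧ x ∈ V ∧ V ⊆ W ∧ IsSaturated U V ∧ (V ∩ U).Nonempty := by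
  by_cases hx : x ∈ U
  · refine ⟨W ∩ U, hW.inter hU.1, ⟨hxW x rfl, hx⟩, inter_subset_left, ?_, ⟨x, ⟨hxW x rfl, hx⟩, hx⟩⟩
    rintro p hp ⟨y, hyp, hy⟩
    exact absurd hy.2 (subset_compl_of_mem_complComponents hp hyp)
  · have hp := mk_mem_complComponents hx
    obtain ⟨V, hVo, hpV, hVW, hsat, hconn⟩ := exists_saturated_nhd hU hp hW fun y hy =>
      hxW y (proj_eq_of_mem hp hy (mem_connectedComponentIn hx))
    exact ⟨V, hVo, hpV (mem_connectedComponentIn hx), hVW, hsat, hconn.1⟩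

theorem isClosed_fiber_proj {U : Set RiemannSphere} (hU : IsOpen U) (x : RiemannSphere) :
    IsClosed {y | proj U y = proj U x} := by
  by_cases hx : x ∈ U
  · convert! isClosed_singleton (x := x) using 1
    ext y
    rw [mem_ofPred_eq, eq_comm, proj_eq_iff_of_mem hx, mem_singleton_iff, eq_comm]
  · convert! isClosed_of_mem_complComponents hU (mk_mem_complComponents hx) using 1
    ext y
    exact proj_eq_iff_mem (mk_mem_complComponents hx) (mem_connectedComponentIn hx)

/-- Distinct fibres are disjoint closed sets. Separating open sets can be shrunk to saturated ones,
which have open images. -/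
theorem t2Space_hat {U : Set RiemannSphere} (hU : IsDomainSet U) : T2Space (Hat U) := by
  refine ⟨fun a b hab => ?_⟩
  obtain ⟨x, rfl⟩ := surjective_proj U a
  obtain ⟨y, rfl⟩ := surjective_proj U b
  obtain ⟨O₁, O₂, hO₁, hO₂, h₁, h₂, hO⟩ := normal_separation
    (isClosed_fiber_proj hU.1 x) (isClosed_fiber_proj hU.1 y)
    (disjoint_left.2 fun z hz hz' => hab (hz.symm.trans hz'))
  obtain ⟨V₁, hV₁, hxV, hVO₁, hs₁, -⟩ := exists_saturated_nhd_of_class hU x hO₁ h₁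
  obtain ⟨V₂, hV₂, hyV, hVO₂, hs₂, -⟩ := exists_saturated_nhd_of_class hU y hO₂ h₂
  refine ⟨_, _, hs₁.isOpen_image_proj hV₁, hs₂.isOpen_image_proj hV₂, ⟨x, hxV, rfl⟩,
    ⟨y, hyV, rfl⟩, ?_⟩
  rw [disjoint_left]
  rintro _ ⟨z, hz, rfl⟩ hz'
  rw [hs₂.proj_mem_image_iff] at hz'
  exact disjoint_left.1 hO (hVO₁ hz) (hVO₂ hz')

/-- Makes continuous extensions unique, so that those of a homeomorphism and of its inverse are
mutually inverse. -/
theorem dense_image_proj {U : Set RiemannSphere} (hU : IsDomainSet U) :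
    Dense (proj U '' U) := by
  rw [dense_iff_inter_open]
  rintro N hN ⟨a, ha⟩
  obtain ⟨x, rfl⟩ := surjective_proj U a
  obtain ⟨V, -, -, hVN, -, ⟨y, hyV, hyU⟩⟩ := exists_saturated_nhd_of_class hU x
    (hN.preimage (continuous_proj U)) (fun y hy => by rwa [mem_preimage, hy])
  exact ⟨proj U y, hVN hyV, ⟨y, hyU, rfl⟩⟩

/-- The cluster set of a homeomorphism between domains at a complementary component lies in a
single complementary component of the image. -/
theorem exists_cluster_component (f : OpenPartialHomeomorph RiemannSphere RiemannSphere)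
    (hU : IsDomainSet f.source) {p : Set RiemannSphere}
    (hp : p ∈ complComponents f.source) :
    ∃ q ∈ complComponents f.target, ∀ O, IsOpen O → q ⊆ O →
      ∃ V, IsOpen V ∧ p ⊆ V ∧ IsSaturated f.source V ∧ closure (f '' (V ∩ f.source)) ⊆ O := by
  set U := f.source with hUdef
  let ι := {V : Set RiemannSphere // IsOpen V ∧ p ⊆ V ∧ IsSaturated U V ∧ IsConnected (V ∩ U)}
  let s : ι → Set RiemannSphere := fun V => closure (f '' (V.1 ∩ U))
  have hne : Nonempty ι := by
    obtain ⟨V, h1, h2, -, h3, h4⟩ := exists_saturated_nhd hU hp isOpen_univ (subset_univ p)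
    exact ⟨⟨V, h1, h2, h3, h4⟩⟩
  have hdir : Directed (· ⊇ ·) s := by
    intro V₁ V₂
    obtain ⟨V, h1, h2, h, h3, h4⟩ := exists_saturated_nhd hU hp (V₁.2.1.inter V₂.2.1)
      (subset_inter V₁.2.2.1 V₂.2.2.1)
    refine ⟨⟨V, h1, h2, h3, h4⟩, closure_mono (image_mono ?_), closure_mono (image_mono ?_)⟩
    · exact inter_subset_inter_left _ (h.trans inter_subset_left)
    · exact inter_subset_inter_left _ (h.trans inter_subset_right)
  have hconn : ∀ i, IsConnected (s i) := fun i =>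
    (i.2.2.2.2.image f (f.continuousOn.mono inter_subset_right)).closure
  have hcl : ∀ i, IsClosed (s i) := fun i => isClosed_closure
  have hC : IsPreconnected (⋂ i, s i) :=
    isPreconnected_iInter_of_directed s hdir hcl fun i => (hconn i).2
  obtain ⟨y, hy⟩ : (⋂ i, s i).Nonempty :=
    IsCompact.nonempty_iInter_of_directed_nonempty_isCompact_isClosed s hdir
      (fun i => (hconn i).1) (fun i => (hcl i).isCompact) hcl
  -- A cluster value in the target would be the image of a point of `U`. That point and `p` have
  -- disjoint neighbourhoods, whose images are disjoint since `f` is injective.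
  have hCD : (⋂ i, s i) ⊆ f.targetᶜ := by
    intro z hz hzD
    have hxU : f.symm z ∈ U := f.map_target hzD
    have hxp : f.symm z ∉ p := fun h => subset_compl_of_mem_complComponents hp h hxU
    obtain ⟨N, W, hN, hW, hxN, hpW, hNW⟩ := normal_separation
      (isClosed_singleton (x := f.symm z)) (isClosed_of_mem_complComponents hU.1 hp)
      (disjoint_singleton_left.2 hxp)
    obtain ⟨V, h1, h2, h, h3, h4⟩ := exists_saturated_nhd hU hp hW hpW
    have hopen : IsOpen (f '' (U ∩ N)) := f.isOpen_image_source_inter hN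
    have hzN : z ∈ f '' (U ∩ N) := ⟨f.symm z, ⟨hxU, hxN rfl⟩, f.right_inv hzD⟩
    obtain ⟨_, ⟨a, ⟨haU, haN⟩, rfl⟩, ⟨b, ⟨hbV, hbU⟩, hab⟩⟩ :=
      mem_closure_iff.1 (mem_iInter.1 hz ⟨V, h1, h2, h3, h4⟩) _ hopen hzN
    have := f.injOn hbU haU hab
    subst this
    exact disjoint_left.1 hNW haN (h hbV)
  refine ⟨_, mk_mem_complComponents (hCD hy), fun O hO hqO => ?_⟩
  obtain ⟨V, hV⟩ := exists_subset_nhds_of_compactSpace hdir hcl (U := O) fun x hx =>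
    hO.mem_nhds (hqO (hC.subset_connectedComponentIn hy hCD hx))
  exact ⟨V.1, V.2.1, V.2.2.1, V.2.2.2.1, hV⟩

/-- A complementary component goes to the class of the target component that attracts its cluster
set. Continuity at components is the point: components near `p` must also be sent near the image of
`p`. -/
theorem exists_continuous_extension (f : OpenPartialHomeomorph RiemannSphere RiemannSphere)
    (hU : IsDomainSet f.source) :
    ∃ F : Hat f.source → Hat f.target, Continuous F ∧
      ∀ x ∈ f.source, F (proj f.source x) = proj f.target (f x) := by
  classical
  set U := f.source with hUdef
  choose! c hc hcO using fun (p : Set RiemannSphere) (hp : p ∈ complComponents U) =>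
    exists_cluster_component f hU hp
  have hcne : ∀ p ∈ complComponents U, ∃ y, y ∈ c p := fun p hp =>
    nonempty_of_mem_complComponents (hc p hp)
  choose! b hb using hcne
  let Φ : RiemannSphere → Hat f.target := fun x =>
    if x ∈ U then proj f.target (f x) else proj f.target (b (connectedComponentIn Uᶜ x))
  have hΦU : ∀ x ∈ U, Φ x = proj f.target (f x) := fun x hx => if_pos hx
  have hΦp : ∀ p ∈ complComponents U, ∀ x ∈ p, ∀ y ∈ c p, Φ x = proj f.target y := by
    intro p hp x hx y hy
    have hxU := subset_compl_of_mem_complComponents hp hx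
    simp only [Φ, if_neg hxU]
    rw [← eq_connectedComponentIn_of_mem hp hx]
    exact proj_eq_of_mem (hc p hp) (hb p hp) hy
  have hcont : Continuous Φ := by
    rw [continuous_iff_continuousAt]
    intro x
    by_cases hx : x ∈ U
    · have h1 : ContinuousAt (fun z => proj f.target (f z)) x :=
        (continuous_proj _).continuousAt.comp (f.continuousAt hx)
      refine h1.congr ?_
      filter_upwards [f.open_source.mem_nhds hx] with z hz
      exact (hΦU z hz).symm
    · have hp := mk_mem_complComponents hx
      set p := connectedComponentIn Uᶜ x with hpdef
      have hxp : x ∈ p := mem_connectedComponentIn hx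
      rw [ContinuousAt, (nhds_basis_opens _).tendsto_right_iff]
      rintro N ⟨hxN, hN⟩
      obtain ⟨V, hV, hpV, hVs, hVO⟩ := hcO p hp (proj f.target ⁻¹' N)
        (hN.preimage (continuous_proj _)) (fun y hy => by
          rw [mem_preimage, ← hΦp p hp x hxp y hy]
          exact hxN)
      filter_upwards [hV.mem_nhds (hpV hxp)] with z hz
      by_cases hzU : z ∈ U
      · rw [hΦU z hzU]
        exact hVO (subset_closure ⟨z, ⟨hz, hzU⟩, rfl⟩)
      · have hq := mk_mem_complComponents hzU
        set q := connectedComponentIn Uᶜ z with hqdef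
        have hzq : z ∈ q := mem_connectedComponentIn hzU
        have hqV : q ⊆ V := hVs q hq ⟨z, hzq, hz⟩
        -- Points of `U` very near `q` have images near `c q`, and they also lie in `V`; hence `c q`
        -- cannot avoid the closure of `f '' (V ∩ U)`.
        have hmeet : (c q ∩ closure (f '' (V ∩ U))).Nonempty := by
          by_contra hne
          obtain ⟨V', hV', hqV', -, hVO'⟩ := hcO q hq (closure (f '' (V ∩ U)))ᶜ
            isClosed_closure.isOpen_compl (fun y hy h => hne ⟨y, hy, h⟩)
          obtain ⟨V'', -, -, hsub, -, ⟨w, hw, hwU⟩, -⟩ :=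
            exists_saturated_nhd hU hq (hV.inter hV') (subset_inter hqV hqV')
          exact hVO' (subset_closure ⟨w, ⟨(hsub hw).2, hwU⟩, rfl⟩)
            (subset_closure ⟨w, ⟨(hsub hw).1, hwU⟩, rfl⟩)
        obtain ⟨y, hyq, hy⟩ := hmeet
        rw [hΦp q hq z hzq y hyq]
        exact hVO hy
  have hresp : ∀ x y, (collapse U) x y → Φ x = Φ y := by
    rintro x y (rfl | ⟨p, hp, hx, hy⟩)
    · rfl
    · obtain ⟨w, hw⟩ := nonempty_of_mem_complComponents (hc p hp)
      rw [hΦp p hp x hx w hw, hΦp p hp y hy w hw]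
  exact ⟨Quotient.lift Φ hresp, hcont.quotient_lift hresp, hΦU⟩

/-- A homeomorphism between domains of the sphere extends to the decomposition spaces. -/
theorem exists_homeomorph_extends (f : OpenPartialHomeomorph RiemannSphere RiemannSphere)
    (hU : IsDomainSet f.source) (hD : IsDomainSet f.target) :
    ∃ F : Hat f.source ≃ₜ Hat f.target, Extends f F := by
  obtain ⟨F, hF, hFf⟩ := exists_continuous_extension f hU
  obtain ⟨G, hG, hGf⟩ : ∃ G : Hat f.target → Hat f.source, Continuous G ∧
      ∀ x ∈ f.target, G (proj f.target x) = proj f.source (f.symm x) :=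
    exists_continuous_extension f.symm hD
  have hT₁ := t2Space_hat hU
  have hT₂ := t2Space_hat hD
  have h1 : G ∘ F = id := by
    refine Continuous.ext_on (dense_image_proj hU) (hG.comp hF) continuous_id ?_
    rintro _ ⟨x, hx, rfl⟩
    simp only [Function.comp_apply, id]
    rw [hFf x hx]
    rw [hGf _ (f.map_source hx), f.left_inv hx]
  have h2 : F ∘ G = id := by
    refine Continuous.ext_on (dense_image_proj hD) (hF.comp hG) continuous_id ?_
    rintro _ ⟨x, hx, rfl⟩
    simp only [Function.comp_apply, id]
    rw [hGf x hx, hFf _ (f.map_target hx), f.right_inv hx]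
  exact ⟨⟨⟨F, G, congrFun h1, congrFun h2⟩, hF, hG⟩, hFf⟩

end RiemannSphere

/-! ### The length-area principle. -/

/-- Change of variables: the real Jacobian of multiplication by `G'` is `‖G'‖ ^ 2`. -/
theorem Complex.lintegral_norm_deriv_sq_eq_volume_image {G : ℂ → ℂ} {R : Set ℂ} (hR : IsOpen R)
    (hG : DifferentiableOn ℂ G R) (hinj : InjOn G R) :
    ∫⁻ z in R, ENNReal.ofReal (‖deriv G z‖ ^ 2) = volume (G '' R) := by
  rw [← lintegral_abs_det_fderiv_eq_addHaar_image volume hR.measurableSet (f := G)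
    (f' := fun z => (ContinuousLinearMap.toSpanSingleton ℂ (deriv G z)).restrictScalars ℝ)
    (fun z hz => ?_) hinj]
  · refine lintegral_congr fun z => ?_
    congr 1
    simp [ContinuousLinearMap.det, LinearMap.det_restrictScalars, Algebra.norm_complex_eq,
      Complex.normSq_eq_norm_sq]
  · have := ((hG z hz).differentiableAt (hR.mem_nhds hz)).hasDerivAt.hasFDerivAt
    exact (this.restrictScalars ℝ).hasFDerivWithinAt

theorem Complex.setLIntegral_reProdIm {F : ℂ → ENNReal} (hF : Measurable F) {s t : Set ℝ}
    (hs : MeasurableSet s) (ht : MeasurableSet t) :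
    ∫⁻ z in s ×ℂ t, F z = ∫⁻ x in s, ∫⁻ y in t, F (x + y * Complex.I) := by
  have hmp := Complex.volume_preserving_equiv_real_prod.symm
  have hms : MeasurableSet (s ×ℂ t) := (Complex.measurable_re hs).inter (Complex.measurable_im ht)
  rw [← hmp.setLIntegral_comp_preimage hms hF]
  have : Complex.measurableEquivRealProd.symm ⁻¹' (s ×ℂ t) = s ×ˢ t := by
    ext ⟨x, y⟩
    simp [Complex.mem_reProdIm]
  rw [this, Measure.volume_eq_prod, ← Measure.prod_restrict, lintegral_prod]
  · refine lintegral_congr fun x => lintegral_congr fun y => ?_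
    congr 1
    apply Complex.ext <;> simp
  · exact (hF.comp Complex.measurableEquivRealProd.symm.measurable).aemeasurable

/-- The integral of `‖G'‖ ^ 2` over the rectangle is the image area, so some vertical segment
carries at most the average `A / (b - a)`. This controls the length of its image; `l` is a free
parameter to be tuned. -/
theorem Complex.exists_vertical_segment_dist_le_of_differentiableOn {G : ℂ → ℂ} {a b c d A l : ℝ}
    (hab : a < b) (hl : 0 < l) (hA : 0 ≤ A)
    (hG : DifferentiableOn ℂ G (Ioo a b ×ℂ Ioo c d)) (hinj : InjOn G (Ioo a b ×ℂ Ioo c d))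
    (hvol : volume (G '' (Ioo a b ×ℂ Ioo c d)) ≤ ENNReal.ofReal A) :
    ∃ s ∈ Ioo a b, ∀ t ∈ Ioo c d, ∀ t' ∈ Ioo c d,
      dist (G (s + t * Complex.I)) (G (s + t' * Complex.I)) ≤
        (l * (d - c) + A / ((b - a) * l)) / 2 := by
  have hRo : IsOpen (Ioo a b ×ℂ Ioo c d) := isOpen_Ioo.reProdIm isOpen_Ioo
  have hba : 0 < b - a := sub_pos.2 hab
  have hmeas : Measurable fun z : ℂ => ENNReal.ofReal (‖deriv G z‖ ^ 2) :=
    ((measurable_deriv G).norm.pow_const 2).ennreal_ofReal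
  have hint := Complex.lintegral_norm_deriv_sq_eq_volume_image hRo hG hinj
  rw [Complex.setLIntegral_reProdIm hmeas measurableSet_Ioo measurableSet_Ioo] at hint
  obtain ⟨s, hs, hsle⟩ := exists_le_setLAverage (μ := volume) (s := Ioo a b)
    (f := fun x : ℝ => ∫⁻ y in Ioo c d, ENNReal.ofReal (‖deriv G (x + y * Complex.I)‖ ^ 2))
    (by simp [hab]) (by simp) (Measurable.aemeasurable (Measurable.lintegral_prod_right'
      (f := fun p : ℝ × ℝ => ENNReal.ofReal (‖deriv G (p.1 + p.2 * Complex.I)‖ ^ 2))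
      (hmeas.comp (by fun_prop : Measurable fun p : ℝ × ℝ => (p.1 + p.2 * Complex.I : ℂ)))))
  rw [setLAverage_eq, hint, Real.volume_Ioo] at hsle
  have hle : ∫⁻ y in Ioo c d, ENNReal.ofReal (‖deriv G (s + y * Complex.I)‖ ^ 2) ≤
      ENNReal.ofReal (A / (b - a)) := by
    refine hsle.trans ?_
    rw [ENNReal.ofReal_div_of_pos hba]
    gcongr
  refine ⟨s, hs, ?_⟩
  have hmemR : ∀ y ∈ Ioo c d, (s + y * Complex.I : ℂ) ∈ Ioo a b ×ℂ Ioo c d := by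
    intro y hy
    simpa [Complex.mem_reProdIm] using ⟨hs, hy⟩
  have hderiv : ∀ y ∈ Ioo c d, HasDerivAt (fun y : ℝ => G (s + y * Complex.I))
      (deriv G (s + y * Complex.I) * Complex.I) y := by
    intro y hy
    have h1 := ((hG _ (hmemR y hy)).differentiableAt (hRo.mem_nhds (hmemR y hy))).hasDerivAt
    have h2 : HasDerivAt (fun y : ℝ => (s + y * Complex.I : ℂ)) Complex.I y := by
      simpa using ((Complex.ofRealCLM.hasDerivAt (x := y)).mul_const Complex.I).const_add (s : ℂ)
    exact h1.comp y h2
  have hcont : ContinuousOn (fun y : ℝ => deriv G (s + y * Complex.I)) (Ioo c d) :=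
    (hG.deriv hRo).continuousOn.comp (by fun_prop) hmemR
  have key : ∀ t ∈ Ioo c d, ∀ t' ∈ Ioo c d, t ≤ t' →
      dist (G (s + t * Complex.I)) (G (s + t' * Complex.I)) ≤
        (l * (d - c) + A / ((b - a) * l)) / 2 := by
    intro t ht t' ht' htt
    have hsub : Icc t t' ⊆ Ioo c d := fun y hy => ⟨ht.1.trans_le hy.1, hy.2.trans_lt ht'.2⟩
    have hu : uIcc t t' ⊆ Ioo c d := by rwa [uIcc_of_le htt]
    have hc' := hcont.mono hu
    have hftc := intervalIntegral.integral_eq_sub_of_hasDerivAt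
      (fun y hy => hderiv y (hu hy)) ((hc'.mul continuousOn_const).intervalIntegrable)
    rw [dist_comm, dist_eq_norm, ← hftc]
    have hsq : ∫ y in t..t', ‖deriv G (s + y * Complex.I)‖ ^ 2 ≤ A / (b - a) := by
      rw [intervalIntegral.integral_of_le htt,
        integral_eq_lintegral_of_nonneg_ae (Eventually.of_forall fun y => sq_nonneg _)]
      · refine ENNReal.toReal_le_of_le_ofReal (by positivity) (le_trans ?_ hle)
        exact lintegral_mono_set (Ioc_subset_Icc_self.trans hsub)
      · exact ((hcont.mono (Ioc_subset_Icc_self.trans hsub)).norm.pow 2).aestronglyMeasurable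
          measurableSet_Ioc
    calc ‖∫ y in t..t', deriv G (s + y * Complex.I) * Complex.I‖
        ≤ ∫ y in t..t', ‖deriv G (s + y * Complex.I) * Complex.I‖ :=
          intervalIntegral.norm_integral_le_integral_norm htt
      -- The inequality `x ≤ (l + x ^ 2 / l) / 2` replaces Cauchy–Schwarz.
      _ ≤ ∫ y in t..t', (l + ‖deriv G (s + y * Complex.I)‖ ^ 2 / l) / 2 := by
          refine intervalIntegral.integral_mono_on htt ?_ ?_ fun y _ => ?_
          · exact ((hc'.mul continuousOn_const).norm).intervalIntegrable
          · exact ((continuousOn_const.add ((hc'.norm.pow 2).div_const l)).div_const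
              2).intervalIntegrable
          · rw [norm_mul, Complex.norm_I, mul_one]
            set x := ‖deriv G (s + y * Complex.I)‖
            have : (l + x ^ 2 / l) / 2 - x = (l - x) ^ 2 / (2 * l) := by
              field_simp
              ring
            have : 0 ≤ (l - x) ^ 2 / (2 * l) := by positivity
            linarith
      _ = (l * (t' - t) + (∫ y in t..t', ‖deriv G (s + y * Complex.I)‖ ^ 2) / l) / 2 := by
          rw [intervalIntegral.integral_div, intervalIntegral.integral_add,
            intervalIntegral.integral_const, intervalIntegral.integral_div, smul_eq_mul, mul_comm l]
          · exact intervalIntegrable_const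
          · exact ((hc'.norm.pow 2).div_const l).intervalIntegrable
      _ ≤ (l * (d - c) + A / ((b - a) * l)) / 2 := by
          rw [← div_div]
          have := ht.1
          have := ht'.2
          gcongr
  intro t ht t' ht'
  rcases le_total t t' with h | h
  · exact key t ht t' ht' h
  · rw [dist_comm]
    exact key t' ht' t ht h

/-- The length-area principle on a rectangle, for holomorphic or antiholomorphic injections. -/
theorem Complex.exists_vertical_segment_dist_le {G : ℂ → ℂ} {a b c d A l : ℝ}
    (hab : a < b) (hl : 0 < l) (hA : 0 ≤ A)
    (hG : DifferentiableOn ℂ G (Ioo a b ×ℂ Ioo c d) ∨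
      DifferentiableOn ℂ (fun z => starRingEnd ℂ (G z)) (Ioo a b ×ℂ Ioo c d))
    (hinj : InjOn G (Ioo a b ×ℂ Ioo c d))
    (hvol : volume (G '' (Ioo a b ×ℂ Ioo c d)) ≤ ENNReal.ofReal A) :
    ∃ s ∈ Ioo a b, ∀ t ∈ Ioo c d, ∀ t' ∈ Ioo c d,
      dist (G (s + t * Complex.I)) (G (s + t' * Complex.I)) ≤
        (l * (d - c) + A / ((b - a) * l)) / 2 := by
  rcases hG with hG | hG
  · exact exists_vertical_segment_dist_le_of_differentiableOn hab hl hA hG hinj hvol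
  · have h := exists_vertical_segment_dist_le_of_differentiableOn hab hl hA hG
      (fun x hx y hy hxy => hinj hx hy ((starRingEnd ℂ).injective hxy)) (by
        have : (fun z => starRingEnd ℂ (G z)) '' (Ioo a b ×ℂ Ioo c d) =
            Complex.conjLIE.symm ⁻¹' (G '' (Ioo a b ×ℂ Ioo c d)) := by
          rw [← LinearIsometryEquiv.image_eq_preimage_symm, image_image]
          rfl
        rw [this, Complex.conjLIE.symm.measurePreserving.measure_preimage_emb
          Complex.conjLIE.symm.toHomeomorph.measurableEmbedding]
        exact hvol)
    simpa only [Complex.dist_conj_conj] using h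

/-! ### The spherical metric and Möbius images of disks. -/

namespace RiemannSphere

theorem toSphere_infty : toSphere OnePoint.infty = !₂[(0 : ℝ), 0, 1] := rfl

theorem toSphere_coe (z : ℂ) : toSphere (z : RiemannSphere) =
    !₂[2 * z.re / (1 + ‖z‖ ^ 2), 2 * z.im / (1 + ‖z‖ ^ 2), (‖z‖ ^ 2 - 1) / (1 + ‖z‖ ^ 2)] := rfl

theorem inner_toSphere_coe (z : ℂ) (v : EuclideanSpace ℝ (Fin 3)) :
    inner ℝ (toSphere (z : RiemannSphere)) v =
      (2 * z.re * v 0 + 2 * z.im * v 1 + (‖z‖ ^ 2 - 1) * v 2) / (1 + ‖z‖ ^ 2) := by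
  have : (1 + ‖z‖ ^ 2) ≠ 0 := by positivity
  rw [toSphere_coe, PiLp.inner_apply, Fin.sum_univ_three]
  simp
  field_simp

theorem inner_toSphere_infty (v : EuclideanSpace ℝ (Fin 3)) :
    inner ℝ (toSphere OnePoint.infty) v = v 2 := by
  rw [toSphere_infty, PiLp.inner_apply, Fin.sum_univ_three]
  simp

theorem inner_toSphere_coe_coe (z w : ℂ) :
    inner ℝ (toSphere (z : RiemannSphere)) (toSphere (w : RiemannSphere)) =
      1 - 2 * ‖z - w‖ ^ 2 / ((1 + ‖z‖ ^ 2) * (1 + ‖w‖ ^ 2)) := by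
  have h1 : (1 + ‖z‖ ^ 2) ≠ 0 := by positivity
  have h2 : (1 + ‖w‖ ^ 2) ≠ 0 := by positivity
  rw [inner_toSphere_coe, toSphere_coe]
  simp only [Matrix.cons_val_zero, Matrix.cons_val_one, Matrix.cons_val]
  field_simp
  simp only [← Complex.normSq_eq_norm_sq, Complex.normSq_apply, Complex.sub_re, Complex.sub_im]
  ring

theorem norm_toSphere (x : RiemannSphere) : ‖toSphere x‖ = 1 := by
  have : inner ℝ (toSphere x) (toSphere x) = 1 := by
    induction x using OnePoint.rec with
    | infty => rw [inner_toSphere_infty, toSphere_infty]; simp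
    | coe z => rw [inner_toSphere_coe_coe]; simp
  rw [real_inner_self_eq_norm_sq] at this
  exact (pow_eq_one_iff_of_nonneg (norm_nonneg _) two_ne_zero).1 this

theorem cos_sphDist (x y : RiemannSphere) :
    Real.cos (sphDist x y) = inner ℝ (toSphere x) (toSphere y) := by
  rw [sphDist, InnerProductGeometry.cos_angle, norm_toSphere, norm_toSphere]
  simp

theorem sphDist_nonneg (x y : RiemannSphere) : 0 ≤ sphDist x y :=
  InnerProductGeometry.angle_nonneg _ _

theorem sphDist_le_pi (x y : RiemannSphere) : sphDist x y ≤ Real.pi :=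
  InnerProductGeometry.angle_le_pi _ _

theorem eq_of_sphDist_nonpos {x y : RiemannSphere} (h : sphDist x y ≤ 0) : x = y := by
  have h0 : sphDist x y = 0 := le_antisymm h (sphDist_nonneg x y)
  have hcos := cos_sphDist x y
  rw [h0, Real.cos_zero] at hcos
  have hne : ∀ z : ℂ, (1 : ℝ) ≠ (‖z‖ ^ 2 - 1) / (1 + ‖z‖ ^ 2) := by
    intro z hz
    rw [eq_div_iff (by positivity)] at hz
    linarith
  induction x using OnePoint.rec with
  | infty =>
    induction y using OnePoint.rec with
    | infty => rfl
    | coe w =>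
      rw [inner_toSphere_infty, toSphere_coe] at hcos
      exact absurd (by simpa using hcos) (hne w)
  | coe z =>
    induction y using OnePoint.rec with
    | infty =>
      rw [real_inner_comm, inner_toSphere_infty, toSphere_coe] at hcos
      exact absurd (by simpa using hcos) (hne z)
    | coe w =>
      rw [inner_toSphere_coe_coe] at hcos
      have h1 : 2 * ‖z - w‖ ^ 2 / ((1 + ‖z‖ ^ 2) * (1 + ‖w‖ ^ 2)) = 0 := by linarith
      rw [div_eq_zero_iff] at h1
      have h2 : (1 + ‖z‖ ^ 2) * (1 + ‖w‖ ^ 2) ≠ 0 := by positivity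
      have h3 : ‖z - w‖ = 0 := by
        have := h1.resolve_right h2
        nlinarith
      rw [sub_eq_zero.1 (norm_eq_zero.1 h3)]

/-- Compares `cos t ≤ 1 - 2 * t ^ 2 / π ^ 2` on `[0, π]` with the chordal formula for the inner
product. -/
theorem sphDist_coe_le (z w : ℂ) : sphDist z w ≤ Real.pi * ‖z - w‖ := by
  have h1 := Real.cos_le_one_sub_mul_cos_sq
    (x := sphDist z w) (by rw [abs_of_nonneg (sphDist_nonneg _ _)]; exact sphDist_le_pi _ _)
  rw [cos_sphDist, inner_toSphere_coe_coe] at h1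
  have h2 : 2 * ‖z - w‖ ^ 2 / ((1 + ‖z‖ ^ 2) * (1 + ‖w‖ ^ 2)) ≤ 2 * ‖z - w‖ ^ 2 := by
    refine div_le_self (by positivity) ?_
    nlinarith [sq_nonneg ‖z‖, sq_nonneg ‖w‖, mul_nonneg (sq_nonneg ‖z‖) (sq_nonneg ‖w‖)]
  have h3 : 2 / Real.pi ^ 2 * sphDist z w ^ 2 ≤ 2 * ‖z - w‖ ^ 2 := by linarith
  have hpi := Real.pi_pos
  refine abs_le_of_sq_le_sq' ?_ (by positivity) |>.2
  rw [div_mul_eq_mul_div, div_le_iff₀ (by positivity)] at h3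
  rw [mul_pow]
  linarith

theorem bddAbove_sphDist (p : Set RiemannSphere) :
    BddAbove {d : ℝ | ∃ x ∈ p, ∃ y ∈ p, d = sphDist x y} :=
  ⟨Real.pi, by rintro _ ⟨x, _, y, _, rfl⟩; exact sphDist_le_pi x y⟩

theorem sphDist_le_sphDiam {p : Set RiemannSphere} {x y : RiemannSphere} (hx : x ∈ p)
    (hy : y ∈ p) : sphDist x y ≤ sphDiam p :=
  le_csSup (bddAbove_sphDist p) ⟨x, hx, y, hy, rfl⟩

theorem sphDiam_nonneg (p : Set RiemannSphere) : 0 ≤ sphDiam p :=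
  Real.sSup_nonneg (by rintro _ ⟨x, _, y, _, rfl⟩; exact sphDist_nonneg x y)

theorem sphDiam_le {p : Set RiemannSphere} {C : ℝ} (hC : 0 ≤ C)
    (h : ∀ x ∈ p, ∀ y ∈ p, sphDist x y ≤ C) : sphDiam p ≤ C :=
  Real.sSup_le (by rintro _ ⟨x, hx, y, hy, rfl⟩; exact h x hx y hy) hC

theorem not_sphDiam_pos_iff {p : Set RiemannSphere} : ¬ 0 < sphDiam p ↔ p.Subsingleton := by
  constructor
  · intro h x hx y hy
    exact eq_of_sphDist_nonpos ((sphDist_le_sphDiam hx hy).trans (not_lt.1 h))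
  · intro h
    refine not_lt.2 (sphDiam_le le_rfl fun x hx y hy => ?_)
    rw [h hx hy, sphDist, InnerProductGeometry.angle_self]
    rw [← norm_pos_iff, norm_toSphere]
    exact one_pos

/-- The set where a quadratic polynomial with negative leading coefficient is nonnegative is
a closed disk. -/
theorem setOf_quadratic_nonneg_eq_closedBall {a b₁ b₂ c : ℝ} (ha : a < 0)
    (hdisc : 0 ≤ b₁ ^ 2 + b₂ ^ 2 - a * c) :
    {z : ℂ | 0 ≤ a * ‖z‖ ^ 2 + 2 * (b₁ * z.re + b₂ * z.im) + c} =
      Metric.closedBall (⟨-b₁ / a, -b₂ / a⟩ : ℂ) (√(b₁ ^ 2 + b₂ ^ 2 - a * c) / (-a)) := by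
  ext z
  have hr : 0 ≤ √(b₁ ^ 2 + b₂ ^ 2 - a * c) / (-a) :=
    div_nonneg (Real.sqrt_nonneg _) (by linarith)
  rw [mem_ofPred_eq, Metric.mem_closedBall, dist_eq_norm, ← abs_of_nonneg hr,
    ← abs_of_nonneg (norm_nonneg (z - _)), ← sq_le_sq, div_pow, Real.sq_sqrt hdisc,
    le_div_iff₀ (by nlinarith)]
  simp only [← Complex.normSq_eq_norm_sq, Complex.normSq_apply, Complex.sub_re, Complex.sub_im]
  have hne := ha.ne
  have : ((z.re - -b₁ / a) * (z.re - -b₁ / a) + (z.im - -b₂ / a) * (z.im - -b₂ / a)) * (-a) ^ 2 =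
      (a * z.re + b₁) ^ 2 + (a * z.im + b₂) ^ 2 := by
    field_simp
    ring
  rw [this]
  constructor
  · intro h
    nlinarith
  · intro h
    have h1 : 0 ≤ -a * (a * (z.re * z.re + z.im * z.im) + 2 * (b₁ * z.re + b₂ * z.im) + c) := by
      nlinarith
    exact nonneg_of_mul_nonneg_right h1 (by linarith)

/-- A Möbius coordinate on the sphere with its pole at `a`. -/
noncomputable def poleCoord : RiemannSphere → RiemannSphere → ℂ
  | none, none => 0
  | none, some w => w
  | some _, none => 0
  | some a, some w => (w - a)⁻¹

theorem poleCoord_infty_coe (w : ℂ) : poleCoord OnePoint.infty w = w := rfl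
theorem poleCoord_coe_infty (a : ℂ) : poleCoord a OnePoint.infty = 0 := rfl
theorem poleCoord_coe_coe (a w : ℂ) : poleCoord a w = (w - a)⁻¹ := rfl

open Classical in
/-- The Möbius transformation `poleCoord a`, as a map of the sphere sending `a` to `∞`. -/
noncomputable def poleMap (a x : RiemannSphere) : RiemannSphere :=
  if x = a then OnePoint.infty else poleCoord a x

theorem poleMap_self (a : RiemannSphere) : poleMap a a = OnePoint.infty := if_pos rfl

theorem poleMap_of_ne {a x : RiemannSphere} (h : x ≠ a) : poleMap a x = poleCoord a x := if_neg h

theorem bijective_poleMap (a : RiemannSphere) : Function.Bijective (poleMap a) := by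
  constructor
  · intro x y hxy
    by_cases hx : x = a
    · by_cases hy : y = a
      · rw [hx, hy]
      · rw [hx, poleMap_self, poleMap_of_ne hy] at hxy
        exact absurd hxy (OnePoint.infty_ne_coe _)
    · by_cases hy : y = a
      · rw [hy, poleMap_self, poleMap_of_ne hx] at hxy
        exact absurd hxy (OnePoint.coe_ne_infty _)
      · rw [poleMap_of_ne hx, poleMap_of_ne hy, OnePoint.coe_eq_coe] at hxy
        induction a using OnePoint.rec with
        | infty =>
          lift x to ℂ using hx
          lift y to ℂ using hy
          rw [poleCoord_infty_coe, poleCoord_infty_coe] at hxy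
          rw [hxy]
        | coe a =>
          induction x using OnePoint.rec with
          | infty =>
            induction y using OnePoint.rec with
            | infty => rfl
            | coe y =>
              rw [poleCoord_coe_infty, poleCoord_coe_coe, eq_comm, inv_eq_zero, sub_eq_zero] at hxy
              exact absurd (congrArg _ hxy) hy
          | coe x =>
            induction y using OnePoint.rec with
            | infty =>
              rw [poleCoord_coe_infty, poleCoord_coe_coe, inv_eq_zero, sub_eq_zero] at hxy
              exact absurd (congrArg _ hxy) hx
            | coe y =>
              rw [poleCoord_coe_coe, poleCoord_coe_coe, inv_inj, sub_left_inj] at hxy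
              rw [hxy]
  · intro y
    induction y using OnePoint.rec with
    | infty => exact ⟨a, poleMap_self a⟩
    | coe y =>
      induction a using OnePoint.rec with
      | infty => exact ⟨y, by rw [poleMap_of_ne (OnePoint.coe_ne_infty y), poleCoord_infty_coe]⟩
      | coe a =>
        by_cases hy : y = 0
        · refine ⟨OnePoint.infty, ?_⟩
          rw [poleMap_of_ne (OnePoint.infty_ne_coe a), poleCoord_coe_infty, hy]
        · refine ⟨((a + y⁻¹ : ℂ) : RiemannSphere), ?_⟩
          rw [poleMap_of_ne, poleCoord_coe_coe]
          · simp
          · rw [Ne, OnePoint.coe_eq_coe]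
            simpa using hy

theorem continuous_poleMap (a : RiemannSphere) : Continuous (poleMap a) := by
  induction a using OnePoint.rec with
  | infty =>
    convert! continuous_id using 1
    funext x
    induction x using OnePoint.rec with
    | infty => exact poleMap_self _
    | coe x => rw [poleMap_of_ne (OnePoint.coe_ne_infty x), poleCoord_infty_coe]; rfl
  | coe a =>
    have hev : ∀ w : ℂ, w ≠ a → poleMap (a : RiemannSphere) w = ((w - a)⁻¹ : ℂ) := fun w hw => by
      rw [poleMap_of_ne (by rwa [Ne, OnePoint.coe_eq_coe]), poleCoord_coe_coe]
    rw [OnePoint.continuous_iff]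
    constructor
    · rw [poleMap_of_ne (OnePoint.infty_ne_coe a), poleCoord_coe_infty]
      have h1 : Tendsto (fun w : ℂ => (w - a)⁻¹) (coclosedCompact ℂ) (𝓝 0) := by
        rw [coclosedCompact_eq_cocompact, ← Metric.cobounded_eq_cocompact]
        exact tendsto_inv₀_cobounded.comp (tendsto_sub_const_cobounded a)
      refine ((OnePoint.continuous_coe.tendsto _).comp h1).congr' ?_
      have : ({a} : Set ℂ)ᶜ ∈ coclosedCompact ℂ := by
        rw [coclosedCompact_eq_cocompact]
        exact isCompact_singleton.compl_mem_cocompact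
      filter_upwards [this] with w hw
      exact (hev w hw).symm
    · rw [continuous_iff_continuousAt]
      intro w
      by_cases hw : w = a
      · subst hw
        rw [ContinuousAt, poleMap_self, ← nhdsNE_sup_pure, tendsto_sup]
        constructor
        · have h1 : Tendsto (fun v : ℂ => (v - w)⁻¹) (𝓝[≠] w) (coclosedCompact ℂ) := by
            rw [coclosedCompact_eq_cocompact, ← Metric.cobounded_eq_cocompact]
            refine tendsto_inv₀_nhdsNE_zero.comp ?_
            refine tendsto_nhdsWithin_iff.2 ⟨?_, ?_⟩
            · have : Tendsto (fun v : ℂ => v - w) (𝓝 w) (𝓝 (w - w)) :=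
                (continuous_id.sub continuous_const).tendsto w
              rw [sub_self] at this
              exact this.mono_left nhdsWithin_le_nhds
            · filter_upwards [self_mem_nhdsWithin] with v hv
              exact sub_ne_zero.2 hv
          refine (OnePoint.tendsto_coe_infty.comp h1).congr' ?_
          filter_upwards [self_mem_nhdsWithin] with v hv
          exact (hev v hv).symm
        · rw [tendsto_pure_left, poleMap_self]
          exact fun s hs => mem_of_mem_nhds hs
      · have h1 : ContinuousAt (fun v : ℂ => (v - a)⁻¹) w :=
          (continuousAt_id.sub continuousAt_const).inv₀ (sub_ne_zero.2 hw)
        refine ((OnePoint.continuous_coe.continuousAt).comp h1).congr ?_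
        filter_upwards [isOpen_ne.mem_nhds hw] with v hv
        exact (hev v hv).symm

/-- The Möbius transformation `poleMap a` as a homeomorphism of the sphere. -/
noncomputable def poleHomeo (a : RiemannSphere) : RiemannSphere ≃ₜ RiemannSphere :=
  Continuous.homeoOfEquivCompactToT2 (f := Equiv.ofBijective _ (bijective_poleMap a))
    (continuous_poleMap a)

theorem poleHomeo_apply (a x : RiemannSphere) : poleHomeo a x = poleMap a x := rfl

theorem mem_sphDist_ball_iff {x c : RiemannSphere} {r : ℝ} (hr₀ : 0 ≤ r) (hr : r ≤ Real.pi) :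
    sphDist x c ≤ r ↔ Real.cos r ≤ inner ℝ (toSphere x) (toSphere c) := by
  rw [← cos_sphDist]
  exact (Real.strictAntiOn_cos.le_iff_ge ⟨hr₀, hr⟩
    ⟨sphDist_nonneg x c, sphDist_le_pi x c⟩).symm

/-- A Möbius transformation maps closed disks avoiding its pole to Euclidean closed disks. -/
theorem image_poleMap_of_isClosedDisk {a : RiemannSphere} {p : Set RiemannSphere}
    (hp : IsClosedDisk p) (ha : a ∉ p) :
    ∃ (c : ℂ) (ρ : ℝ), 0 ≤ ρ ∧
      poleMap a '' p = (fun z : ℂ => (z : RiemannSphere)) '' Metric.closedBall c ρ := by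
  obtain ⟨c, r, hr₀, hr, rfl⟩ := hp
  set n := toSphere c with hn
  set k := Real.cos r with hk
  have hk1 : k ^ 2 ≤ 1 := Real.cos_sq_le_one r
  have hnorm : n 0 ^ 2 + n 1 ^ 2 + n 2 ^ 2 = 1 := by
    have := norm_toSphere c
    rw [EuclideanSpace.norm_eq, Fin.sum_univ_three, Real.sqrt_eq_one] at this
    simpa using this
  -- A spherical disk is the part of the sphere in a half-space. Under stereographic projection this
  -- becomes a quadratic inequality with leading coefficient `A`, constant term `C` and discriminant
  -- `1 - k ^ 2 = sin r ^ 2`.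
  set A := n 2 - k with hA
  set C := -n 2 - k with hC
  have hdisc : n 0 ^ 2 + n 1 ^ 2 - A * C = 1 - k ^ 2 := by
    rw [hA, hC]
    linear_combination hnorm
  have hinf : OnePoint.infty ∈ {x | sphDist x c ≤ r} ↔ 0 ≤ A := by
    rw [mem_ofPred_eq, mem_sphDist_ball_iff hr₀.le hr.le, inner_toSphere_infty, hA, sub_nonneg]
  have hcoe : ∀ w : ℂ, (w : RiemannSphere) ∈ {x | sphDist x c ≤ r} ↔
      0 ≤ A * ‖w‖ ^ 2 + 2 * (n 0 * w.re + n 1 * w.im) + C := by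
    intro w
    rw [mem_ofPred_eq, mem_sphDist_ball_iff hr₀.le hr.le, inner_toSphere_coe,
      le_div_iff₀ (by positivity), ← sub_nonneg, hA, hC, ← hn, ← hk]
    ring_nf
  set H : ℂ → ℝ := fun w => A * ‖w‖ ^ 2 + 2 * (n 0 * w.re + n 1 * w.im) + C with hH
  obtain ⟨α, β₁, β₂, γ, hα, hdisc', hset⟩ : ∃ α β₁ β₂ γ : ℝ, α < 0 ∧
      0 ≤ β₁ ^ 2 + β₂ ^ 2 - α * γ ∧ ∀ x, x ≠ a → (x ∈ {x | sphDist x c ≤ r} ↔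
        0 ≤ α * ‖poleCoord a x‖ ^ 2 +
          2 * (β₁ * (poleCoord a x).re + β₂ * (poleCoord a x).im) + γ) := by
    induction a using OnePoint.rec with
    | infty =>
      refine ⟨A, n 0, n 1, C, not_le.1 fun h => ha (hinf.2 h), by rw [hdisc]; linarith, ?_⟩
      intro x hx
      lift x to ℂ using hx
      exact hcoe x
    | coe a =>
      rw [hcoe, not_le] at ha
      -- Substituting `x = a + 1 / u` and multiplying by `‖u‖ ^ 2` exchanges the roles of the
      -- coefficients. The new leading coefficient is the value at the pole, negative because the
      -- pole is outside the disk; the discriminant is unchanged.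
      refine ⟨H a, A * a.re + n 0, -(A * a.im + n 1), A, ha, ?_, ?_⟩
      · have : (A * a.re + n 0) ^ 2 + (-(A * a.im + n 1)) ^ 2 - H a * A = 1 - k ^ 2 := by
          rw [← hdisc, hH]
          simp only [← Complex.normSq_eq_norm_sq, Complex.normSq_apply]
          ring
        rw [this]
        linarith
      · intro x hx
        induction x using OnePoint.rec with
        | infty => rw [hinf, poleCoord_coe_infty]; simp
        | coe x =>
          have hxa : x - a ≠ 0 := sub_ne_zero.2 fun h => hx (congrArg _ h)
          rw [hcoe, poleCoord_coe_coe]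
          set u := (x - a)⁻¹ with hu
          have hu0 : u ≠ 0 := inv_ne_zero hxa
          have hxu : x - a = u⁻¹ := by rw [hu, inv_inv]
          have hpos : 0 < u.re * u.re + u.im * u.im := by
            rw [← Complex.normSq_apply]
            exact Complex.normSq_pos.2 hu0
          have hre : x.re = a.re + u.re / (u.re * u.re + u.im * u.im) := by
            have := congrArg Complex.re hxu
            rw [Complex.inv_re, Complex.normSq_apply, Complex.sub_re] at this
            linarith
          have him : x.im = a.im - u.im / (u.re * u.re + u.im * u.im) := by
            have := congrArg Complex.im hxu
            rw [Complex.inv_im, Complex.normSq_apply, Complex.sub_im, neg_div] at this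
            linarith
          have key : H a * ‖u‖ ^ 2 + 2 * ((A * a.re + n 0) * u.re + -(A * a.im + n 1) * u.im) + A =
              (A * ‖x‖ ^ 2 + 2 * (n 0 * x.re + n 1 * x.im) + C) *
                (u.re * u.re + u.im * u.im) := by
            simp only [hH, ← Complex.normSq_eq_norm_sq, Complex.normSq_apply]
            rw [hre, him]
            have hne := hpos.ne'
            generalize hD : u.re * u.re + u.im * u.im = D at hne ⊢
            field_simp
            linear_combination (-A) * hD
          rw [key]
          exact (mul_nonneg_iff_of_pos_right hpos).symm
  refine ⟨⟨-β₁ / α, -β₂ / α⟩, √(β₁ ^ 2 + β₂ ^ 2 - α * γ) / (-α),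
    div_nonneg (Real.sqrt_nonneg _) (neg_nonneg.2 hα.le), ?_⟩
  rw [← setOf_quadratic_nonneg_eq_closedBall hα hdisc']
  ext y
  constructor
  · rintro ⟨x, hx, rfl⟩
    have hxa : x ≠ a := fun h => ha (h ▸ hx)
    exact ⟨poleCoord a x, (hset x hxa).1 hx, (poleMap_of_ne hxa).symm⟩
  · rintro ⟨z, hz, rfl⟩
    obtain ⟨x, hx⟩ := (bijective_poleMap a).2 z
    have hxa : x ≠ a := by
      rintro rfl
      rw [poleMap_self] at hx
      exact OnePoint.infty_ne_coe _ hx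
    refine ⟨x, (hset x hxa).2 ?_, hx⟩
    rw [poleMap_of_ne hxa, OnePoint.coe_eq_coe] at hx
    rw [hx]
    exact hz

/-- Between the standard chart at `f z` and the coordinate with pole `a` there is a Möbius change of
variable, regular at `f z` because `f z ≠ a`. -/
theorem differentiableAt_poleCoord_comp {f : RiemannSphere → RiemannSphere} {a : RiemannSphere}
    {z : ℂ} (hf : HolomorphicAt f z) (ha : f z ≠ a) :
    DifferentiableAt ℂ (fun w : ℂ => poleCoord a (f w)) z := by
  obtain ⟨hc, han⟩ := hf
  have hd : DifferentiableAt ℂ (fun w : ℂ => coordAt (f z) (f w)) z := han.differentiableAt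
  have hc' : ContinuousAt (fun w : ℂ => f w) z := hc.comp OnePoint.continuous_coe.continuousAt
  generalize hfz : f z = b at *
  induction b using OnePoint.rec with
  | infty =>
    induction a using OnePoint.rec with
    | infty => exact absurd rfl ha
    | coe a =>
      -- At the value `0` the coordinate at `∞` takes a default value and the identity `1 / (v - a)
      -- = v⁻¹ / (1 - a * v⁻¹)` can fail; such points stay away from `z`.
      have h0 : ∀ᶠ w : ℂ in 𝓝 z, f w ≠ ((0 : ℂ) : RiemannSphere) :=
        hc'.eventually_ne (by rw [hfz]; exact OnePoint.infty_ne_coe 0)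
      have hz0 : coordAt OnePoint.infty (f z) = 0 := by rw [hfz]; rfl
      have h1 : DifferentiableAt ℂ (fun w : ℂ => coordAt OnePoint.infty (f w) /
          (1 - a * coordAt OnePoint.infty (f w))) z := by
        refine hd.div ((differentiableAt_const _).sub (hd.const_mul a)) ?_
        rw [hz0]
        simp
      refine h1.congr_of_eventuallyEq ?_
      filter_upwards [h0] with w hw
      generalize f w = y at hw
      induction y using OnePoint.rec with
      | infty =>
        rw [poleCoord_coe_infty]
        change _ = (0 : ℂ) / _
        simp
      | coe v =>
        have hv : v ≠ 0 := fun h => hw (congrArg _ h)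
        rw [poleCoord_coe_coe]
        change _ = v⁻¹ / (1 - a * v⁻¹)
        field_simp
  | coe b =>
    have h0 : ∀ᶠ w : ℂ in 𝓝 z, f w ≠ OnePoint.infty :=
      hc'.eventually_ne (by rw [hfz]; exact OnePoint.coe_ne_infty b)
    induction a using OnePoint.rec with
    | infty =>
      refine hd.congr_of_eventuallyEq ?_
      filter_upwards [h0] with w hw
      generalize f w = y at hw
      lift y to ℂ using hw
      rfl
    | coe a =>
      have h1 : DifferentiableAt ℂ (fun w : ℂ => (coordAt b (f w) - a)⁻¹) z := by
        refine (hd.sub_const a).inv ?_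
        rw [hfz]
        change b - a ≠ 0
        exact sub_ne_zero.2 fun h => ha (congrArg _ h)
      refine h1.congr_of_eventuallyEq ?_
      filter_upwards [h0] with w hw
      generalize f w = y at hw
      lift y to ℂ using hw
      rfl

theorem poleCoord_conj (a x : RiemannSphere) :
    poleCoord (conj a) (conj x) = starRingEnd ℂ (poleCoord a x) := by
  induction a using OnePoint.rec with
  | infty =>
    induction x using OnePoint.rec with
    | infty => exact (map_zero _).symm
    | coe x => rfl
  | coe a =>
    induction x using OnePoint.rec with
    | infty => exact (map_zero _).symm
    | coe x =>
      change (starRingEnd ℂ x - starRingEnd ℂ a)⁻¹ = starRingEnd ℂ (x - a)⁻¹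
      rw [map_inv₀, map_sub]

theorem injective_conj : Function.Injective conj := by
  refine Option.map_injective (starRingEnd ℂ).injective

theorem differentiableOn_poleCoord_comp {f : OpenPartialHomeomorph RiemannSphere RiemannSphere}
    (hf : IsConformal f) {a : RiemannSphere} {S : Set ℂ}
    (hS : ∀ z ∈ S, (z : RiemannSphere) ∈ f.source) (ha : ∀ z ∈ S, f z ≠ a) :
    DifferentiableOn ℂ (fun w : ℂ => poleCoord a (f w)) S ∨
      DifferentiableOn ℂ (fun w : ℂ => starRingEnd ℂ (poleCoord a (f w))) S := by
  rcases hf with hf | hf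
  · exact Or.inl fun z hz => (differentiableAt_poleCoord_comp (hf z (hS z hz))
      (ha z hz)).differentiableWithinAt
  · refine Or.inr fun z hz => ?_
    have := differentiableAt_poleCoord_comp (a := conj a) (hf z (hS z hz))
      (fun h => ha z hz (injective_conj h))
    simp only [Function.comp_apply, poleCoord_conj] at this
    exact this.differentiableWithinAt

end RiemannSphere

/-! ### The domain: rings of arcs accumulating on the unit disk. -/

namespace RiemannSphere

noncomputable section

/-- Logarithm of the radius of the `j`-th ring of arcs. -/
def ringLog (j : ℕ) : ℝ := 1 / (j + 1)

/-- Angular distance between the midpoints of two consecutive gaps of the `j`-th ring. -/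
def ringStep (j : ℕ) : ℝ := 2 * Real.pi / (j + 1)

/-- Upper bound for the radius, in logarithmic coordinates, of the crosscuts at the `j`-th ring. -/
def bumpRadius (j : ℕ) : ℝ := 1 / (2 * (j + 1) ^ 2)

/-- Half of the angular width of the gaps of the `j`-th ring. -/
def gapWidth (j : ℕ) : ℝ := bumpRadius j * Real.exp (-(j + 1) ^ 4)

/-- The `k`-th arc of the `j`-th ring. -/
def ringArc (j k : ℕ) : Set ℂ :=
  (fun θ : ℝ => Complex.exp (ringLog j + θ * Complex.I)) ''
    Icc (k * ringStep j + gapWidth j) ((k + 1) * ringStep j - gapWidth j)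

/-- The union of the closed unit disk and of all arcs. -/
def diskWithArcs : Set ℂ :=
  Metric.closedBall 0 1 ∪ ⋃ j : ℕ, ⋃ k ∈ Finset.range (j + 1), ringArc j k

/-- The complement of the closed unit disk and of all arcs. -/
def arcDomain : Set RiemannSphere := ((fun z : ℂ => (z : RiemannSphere)) '' diskWithArcs)ᶜ

theorem ringLog_pos (j : ℕ) : 0 < ringLog j := by unfold ringLog; positivity

theorem ringLog_le_one (j : ℕ) : ringLog j ≤ 1 := by
  unfold ringLog
  rw [div_le_one (by positivity)]
  linarith [(Nat.cast_nonneg j : (0 : ℝ) ≤ j)]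

theorem ringStep_pos (j : ℕ) : 0 < ringStep j := by
  have := Real.pi_pos
  unfold ringStep; positivity

theorem bumpRadius_pos (j : ℕ) : 0 < bumpRadius j := by unfold bumpRadius; positivity

theorem bumpRadius_le_half (j : ℕ) : bumpRadius j ≤ 1 / 2 := by
  unfold bumpRadius
  have : (0 : ℝ) ≤ j := Nat.cast_nonneg j
  apply one_div_le_one_div_of_le <;> nlinarith

theorem gapWidth_pos (j : ℕ) : 0 < gapWidth j := mul_pos (bumpRadius_pos j) (Real.exp_pos _)

theorem gapWidth_lt_bumpRadius (j : ℕ) : gapWidth j < bumpRadius j := by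
  refine mul_lt_of_lt_one_right (bumpRadius_pos j) ?_
  rw [Real.exp_lt_one_iff, neg_lt_zero]
  positivity

theorem two_mul_bumpRadius_lt_ringStep (j : ℕ) : 2 * bumpRadius j < ringStep j := by
  unfold bumpRadius ringStep
  have h0 : (0 : ℝ) ≤ j := Nat.cast_nonneg j
  have := Real.pi_gt_three
  rw [mul_one_div, div_lt_div_iff₀ (by positivity) (by positivity)]
  nlinarith [sq_nonneg (j : ℝ)]

theorem ringStep_mul (j : ℕ) : (j + 1) * ringStep j = 2 * Real.pi := by
  unfold ringStep
  have : (j : ℝ) + 1 ≠ 0 := by positivity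
  field_simp

/-- The gap neighbourhoods of a ring stay strictly inside the next larger ring: `1 / (j + 1) + 1 /
(2 * (j + 1) ^ 2) < 1 / j`. -/
theorem ringLog_add_bumpRadius_lt {i j : ℕ} (h : i < j) :
    ringLog j + bumpRadius j < ringLog i := by
  unfold ringLog bumpRadius
  have h0 : (0 : ℝ) ≤ i := Nat.cast_nonneg i
  have h1 : (i : ℝ) + 1 ≤ j := by exact_mod_cast h
  have h2 : 1 / (j : ℝ) ≤ 1 / (i + 1) := one_div_le_one_div_of_le (by positivity) h1
  refine lt_of_lt_of_le ?_ h2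
  have hj : (0 : ℝ) < j := by linarith
  rw [div_add_div _ _ (by positivity) (by positivity), div_lt_div_iff₀ (by positivity)
    (by positivity)]
  nlinarith [sq_nonneg (j : ℝ), pow_pos hj 2, pow_pos hj 3]

theorem ringLog_strictAnti : StrictAnti ringLog := fun i j h => by
  linarith [ringLog_add_bumpRadius_lt h, bumpRadius_pos j]

theorem ne_ringLog_of_lt_add_bumpRadius {j : ℕ} {t : ℝ} (h₁ : ringLog j < t)
    (h₂ : t < ringLog j + bumpRadius j) (m : ℕ) : t ≠ ringLog m := by
  rcases lt_or_ge m j with h | h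
  · exact (h₂.trans (ringLog_add_bumpRadius_lt h)).ne
  · exact (lt_of_le_of_lt (ringLog_strictAnti.antitone h) h₁).ne'

theorem ne_ringLog_of_between {j : ℕ} {t : ℝ} (h₁ : ringLog (j + 1) < t) (h₂ : t < ringLog j)
    (m : ℕ) : t ≠ ringLog m := by
  rcases le_or_gt m j with h | h
  · exact (lt_of_lt_of_le h₂ (ringLog_strictAnti.antitone h)).ne
  · exact (lt_of_le_of_lt (ringLog_strictAnti.antitone h) h₁).ne'

theorem tendsto_ringLog : Tendsto ringLog atTop (𝓝 0) := tendsto_one_div_add_atTop_nhds_zero_nat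

theorem norm_exp_add_mul_I (x θ : ℝ) : ‖Complex.exp (x + θ * Complex.I)‖ = Real.exp x := by
  rw [Complex.norm_exp]
  simp

theorem norm_of_mem_ringArc {j k : ℕ} {z : ℂ} (hz : z ∈ ringArc j k) :
    ‖z‖ = Real.exp (ringLog j) := by
  obtain ⟨θ, -, rfl⟩ := hz
  exact norm_exp_add_mul_I _ _

theorem exp_mem_ringArc_iff {j k : ℕ} {x θ : ℝ} :
    Complex.exp (x + θ * Complex.I) ∈ ringArc j k ↔ x = ringLog j ∧ ∃ n : ℤ,
      θ + n * (2 * Real.pi) ∈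
        Icc (k * ringStep j + gapWidth j) ((k + 1) * ringStep j - gapWidth j) := by
  constructor
  · rintro ⟨τ, hτ, h⟩
    obtain ⟨n, hn⟩ := Complex.exp_eq_exp_iff_exists_int.1 h
    have hre := congrArg Complex.re hn
    have him := congrArg Complex.im hn
    simp at hre him
    exact ⟨hre.symm, n, by rwa [← him]⟩
  · rintro ⟨rfl, n, hn⟩
    refine ⟨_, hn, ?_⟩
    refine Complex.exp_eq_exp_iff_exists_int.2 ⟨n, ?_⟩
    push_cast
    ring

theorem isCompact_ringArc (j k : ℕ) : IsCompact (ringArc j k) :=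
  isCompact_Icc.image (by fun_prop)

theorem isPreconnected_ringArc (j k : ℕ) : IsPreconnected (ringArc j k) :=
  isPreconnected_Icc.image _ (by fun_prop)

theorem ringArc_endpoints_lt (j k : ℕ) :
    k * ringStep j + gapWidth j < (k + 1) * ringStep j - gapWidth j := by
  have := two_mul_bumpRadius_lt_ringStep j
  have := gapWidth_lt_bumpRadius j
  linarith

/-- No arc crosses the positive real axis, which therefore runs through a gap of every ring. The
bounds also remove the `2π` ambiguity when arcs are compared. -/
theorem ringArc_angle_mem {j k : ℕ} (hk : k < j + 1) {θ : ℝ}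
    (hθ : θ ∈ Icc (k * ringStep j + gapWidth j) ((k + 1) * ringStep j - gapWidth j)) :
    0 < θ ∧ θ < 2 * Real.pi := by
  have h1 := gapWidth_pos j
  have h2 := ringStep_pos j
  have h3 : (k : ℝ) + 1 ≤ j + 1 := by exact_mod_cast hk
  have h4 : (0 : ℝ) ≤ k * ringStep j := by positivity
  have h5 : ((k : ℝ) + 1) * ringStep j ≤ (j + 1) * ringStep j := by gcongr
  rw [ringStep_mul] at h5
  exact ⟨by linarith [hθ.1], by linarith [hθ.2]⟩

theorem disjoint_ringArc {j k k' : ℕ} (hk : k < j + 1) (hk' : k' < j + 1) (h : k ≠ k') :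
    Disjoint (ringArc j k) (ringArc j k') := by
  rw [disjoint_left]
  rintro _ ⟨θ, hθ, rfl⟩ hz
  obtain ⟨-, n, hn⟩ := exp_mem_ringArc_iff.1 hz
  have h1 := ringArc_angle_mem hk hθ
  have h2 := ringArc_angle_mem hk' hn
  have hpi := Real.pi_pos
  have hn0 : n = 0 := by
    have a1 : (n : ℝ) < 1 := by by_contra hc; nlinarith
    have a2 : (-1 : ℝ) < n := by by_contra hc; nlinarith
    have a1' : n < 1 := by exact_mod_cast a1
    have a2' : -1 < n := by exact_mod_cast a2
    omega
  subst hn0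
  simp only [Int.cast_zero, zero_mul, add_zero] at hn
  have hη := gapWidth_pos j
  have hs := ringStep_pos j
  rcases lt_or_gt_of_ne h with hlt | hlt
  · have : ((k : ℝ) + 1) * ringStep j ≤ k' * ringStep j := by
      have : (k : ℝ) + 1 ≤ k' := by exact_mod_cast hlt
      gcongr
    linarith [hθ.2, hn.1]
  · have : ((k' : ℝ) + 1) * ringStep j ≤ k * ringStep j := by
      have : (k' : ℝ) + 1 ≤ k := by exact_mod_cast hlt
      gcongr
    linarith [hθ.1, hn.2]

theorem mem_diskWithArcs {z : ℂ} :
    z ∈ diskWithArcs ↔ ‖z‖ ≤ 1 ∨ ∃ j k, k < j + 1 ∧ z ∈ ringArc j k := by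
  simp [diskWithArcs]

theorem coe_mem_arcDomain {z : ℂ} : (z : RiemannSphere) ∈ arcDomain ↔ z ∉ diskWithArcs := by
  rw [arcDomain, mem_compl_iff, OnePoint.coe_injective.mem_set_image]

theorem infty_mem_arcDomain : OnePoint.infty ∈ arcDomain := by
  rintro ⟨z, -, hz⟩
  exact OnePoint.coe_ne_infty z hz

theorem exp_mem_arcDomain_of_ne {x θ : ℝ} (hx : 0 < x) (h : ∀ m, x ≠ ringLog m) :
    ((Complex.exp (x + θ * Complex.I) : ℂ) : RiemannSphere) ∈ arcDomain := by
  rw [coe_mem_arcDomain, mem_diskWithArcs, not_or]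
  refine ⟨?_, ?_⟩
  · rw [norm_exp_add_mul_I, not_le]
    exact Real.one_lt_exp_iff.2 hx
  · rintro ⟨j, k, -, hz⟩
    exact h j (exp_mem_ringArc_iff.1 hz).1

theorem ofReal_exp_mem_arcDomain {x : ℝ} (hx : 0 < x) :
    ((Complex.exp x : ℂ) : RiemannSphere) ∈ arcDomain := by
  rw [coe_mem_arcDomain, mem_diskWithArcs, not_or]
  have h0 : Complex.exp x = Complex.exp (x + (0 : ℝ) * Complex.I) := by simp
  rw [h0]
  refine ⟨?_, ?_⟩
  · rw [norm_exp_add_mul_I, not_le]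
    exact Real.one_lt_exp_iff.2 hx
  · rintro ⟨j, k, hk, hz⟩
    obtain ⟨-, n, hn⟩ := exp_mem_ringArc_iff.1 hz
    obtain ⟨h1, h2⟩ := ringArc_angle_mem hk hn
    have hpi := Real.pi_pos
    rw [zero_add] at h1 h2
    have a1 : (0 : ℝ) < n := by by_contra hc; nlinarith
    have a2 : (n : ℝ) < 1 := by by_contra hc; nlinarith
    have a1' : 0 < n := by exact_mod_cast a1
    have a2' : n < 1 := by exact_mod_cast a2
    omega

theorem isClosed_diskWithArcs : IsClosed diskWithArcs := by
  -- The rings accumulate only on the unit circle. Replacing all rings from the `n`-th on by a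
  -- slightly larger disk leaves a finite union of closed sets.
  have : diskWithArcs = ⋂ n : ℕ, (Metric.closedBall 0 (Real.exp (ringLog n)) ∪
      ⋃ j ∈ Finset.range n, ⋃ k ∈ Finset.range (j + 1), ringArc j k) := by
    ext z
    simp only [mem_iInter, mem_union, mem_closedBall_zero_iff, mem_iUnion, Finset.mem_range,
      exists_prop, mem_diskWithArcs]
    constructor
    · rintro (h | ⟨j, k, hk, h⟩) n
      · exact Or.inl (h.trans (Real.one_le_exp (ringLog_pos n).le))
      · rcases lt_or_ge j n with hj | hj
        · exact Or.inr ⟨j, hj, k, hk, h⟩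
        · left
          rw [norm_of_mem_ringArc h]
          exact Real.exp_le_exp.2 (ringLog_strictAnti.antitone hj)
    · intro h
      by_cases hz : ‖z‖ ≤ 1
      · exact Or.inl hz
      · right
        have hlim : Tendsto (fun n => Real.exp (ringLog n)) atTop (𝓝 1) := by
          rw [← Real.exp_zero]
          exact (Real.continuous_exp.tendsto 0).comp tendsto_ringLog
        obtain ⟨n, hn⟩ := (hlim.eventually_lt_const (not_le.1 hz)).exists
        obtain ⟨j, -, k, hk, h⟩ := (h n).resolve_left (not_le.2 hn)
        exact ⟨j, k, hk, h⟩
  rw [this]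
  refine isClosed_iInter fun n => Metric.isClosed_closedBall.union ?_
  refine isClosed_biUnion_finset fun j _ => isClosed_biUnion_finset fun k _ => ?_
  exact (isCompact_ringArc j k).isClosed

theorem isCompact_diskWithArcs : IsCompact diskWithArcs := by
  refine (isCompact_closedBall (0 : ℂ) (Real.exp 1)).of_isClosed_subset isClosed_diskWithArcs ?_
  intro z hz
  rw [mem_closedBall_zero_iff]
  rcases mem_diskWithArcs.1 hz with h | ⟨j, k, -, h⟩
  · exact h.trans (Real.one_le_exp zero_le_one)
  · rw [norm_of_mem_ringArc h]
    exact Real.exp_le_exp.2 (ringLog_le_one j)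

theorem isOpen_arcDomain : IsOpen arcDomain := by
  rw [arcDomain, isOpen_compl_iff]
  exact OnePoint.isClosed_image_coe.2 ⟨isClosed_diskWithArcs, isCompact_diskWithArcs⟩

theorem convex_reProdIm {s t : Set ℝ} (hs : Convex ℝ s) (ht : Convex ℝ t) :
    Convex ℝ (s ×ℂ t) :=
  (hs.linear_preimage Complex.reLm).inter (ht.linear_preimage Complex.imLm)

/-- Every point is joined to the positive real ray beyond `1`. A short radial move outwards leaves a
ring if necessary, and then the whole circle of the new radius is free of arcs and meets the ray.
The point `∞` is in the closure of the ray. -/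
theorem isConnected_arcDomain : IsConnected arcDomain := by
  refine ⟨⟨_, infty_mem_arcDomain⟩, ?_⟩
  set ψ : ℂ → RiemannSphere := fun w => (Complex.exp w : ℂ) with hψ
  have hψc : Continuous ψ := OnePoint.continuous_coe.comp Complex.continuous_exp
  set R : Set ℂ := Ioi 0 ×ℂ {0} with hR
  have hRc : IsPreconnected R := (convex_reProdIm (convex_Ioi 0) (convex_singleton 0)).isPreconnected
  have hRU : ψ '' R ⊆ arcDomain := by
    rintro _ ⟨w, ⟨hw1, hw2⟩, rfl⟩
    have hw : w = (w.re : ℂ) := by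
      apply Complex.ext
      · simp
      · simpa using hw2
    rw [hψ, hw]
    exact ofReal_exp_mem_arcDomain hw1
  have h1R : ψ 1 ∈ ψ '' R := ⟨1, by simp [hR, Complex.mem_reProdIm], rfl⟩
  refine isPreconnected_of_forall (ψ 1) fun y hy => ?_
  induction y using OnePoint.rec with
  | infty =>
    refine ⟨insert OnePoint.infty (ψ '' R), insert_subset hy hRU, Or.inr h1R, Or.inl rfl, ?_⟩
    refine (hRc.image ψ hψc.continuousOn).subset_closure (subset_insert _ _)
      (insert_subset ?_ subset_closure)
    have hlim : Tendsto (fun t : ℝ => ψ t) atTop (𝓝 OnePoint.infty) := by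
      refine OnePoint.tendsto_coe_infty.comp ?_
      rw [coclosedCompact_eq_cocompact, ← Metric.cobounded_eq_cocompact,
        ← tendsto_norm_atTop_iff_cobounded]
      have : (fun t : ℝ => ‖Complex.exp t‖) = Real.exp := by
        funext t
        simp [Complex.norm_exp]
      rw [this]
      exact Real.tendsto_exp_atTop
    refine mem_closure_of_tendsto hlim ?_
    filter_upwards [eventually_gt_atTop 0] with t ht
    exact ⟨t, by simpa [hR, Complex.mem_reProdIm] using ht, rfl⟩
  | coe z =>
    have hz := coe_mem_arcDomain.1 hy
    rw [mem_diskWithArcs, not_or, not_le] at hz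
    have hz0 : z ≠ 0 := by
      rintro rfl
      simp at hz
      linarith [hz.1]
    set x := (Complex.log z).re with hx
    set θ := (Complex.log z).im with hθ
    have hzexp : z = Complex.exp (x + θ * Complex.I) := by
      rw [hx, hθ, Complex.re_add_im, Complex.exp_log hz0]
    have hx0 : 0 < x := by
      rw [← Real.one_lt_exp_iff, ← norm_exp_add_mul_I x θ, ← hzexp]
      exact hz.1
    obtain ⟨x', hxx', hx'⟩ : ∃ x' ≥ x, (∀ s, x < s → s ≤ x' → ∀ m, s ≠ ringLog m) ∧
        ∀ m, x' ≠ ringLog m := by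
      by_cases h : ∃ j, x = ringLog j
      · obtain ⟨j, hj⟩ := h
        have hb := bumpRadius_pos j
        refine ⟨x + bumpRadius j / 2, by linarith, fun s hs hs' => ?_, ?_⟩ <;>
        apply ne_ringLog_of_lt_add_bumpRadius (j := j) <;> linarith
      · push Not at h
        exact ⟨x, le_rfl, fun s hs hs' => absurd hs' (not_le.2 hs), h⟩
    set S₁ : Set ℂ := {x'} ×ℂ univ with hS₁
    set S₂ : Set ℂ := Icc x x' ×ℂ {θ} with hS₂
    have hS₁U : ψ '' S₁ ⊆ arcDomain := by
      rintro _ ⟨w, ⟨hw1, -⟩, rfl⟩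
      have hw1' : w.re = x' := hw1
      rw [hψ, ← Complex.re_add_im w]
      exact exp_mem_arcDomain_of_ne (by rw [hw1']; linarith) (by rw [hw1']; exact hx'.2)
    have hS₂U : ψ '' S₂ ⊆ arcDomain := by
      rintro _ ⟨w, ⟨hw1, hw2⟩, rfl⟩
      have hw1' : x ≤ w.re ∧ w.re ≤ x' := hw1
      have hw2' : w.im = θ := hw2
      rcases hw1'.1.eq_or_lt with h | h
      · have : ψ w = z := by
          rw [hψ, hzexp, h, ← hw2', Complex.re_add_im]
        rwa [this]
      · rw [hψ, ← Complex.re_add_im w]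
        exact exp_mem_arcDomain_of_ne (by linarith) (hx'.1 _ h hw1'.2)
    have hSc : IsPreconnected (R ∪ S₁ ∪ S₂) := by
      refine (hRc.union (x' : ℂ) ?_ ?_ ?_).union (x' + θ * Complex.I : ℂ) ?_ ?_ ?_
      · simp only [hR, Complex.mem_reProdIm, Complex.ofReal_re, Complex.ofReal_im]
        exact ⟨by simp only [mem_Ioi]; linarith, rfl⟩
      · simp [hS₁, Complex.mem_reProdIm]
      · exact (convex_reProdIm (convex_singleton _) convex_univ).isPreconnected
      · right
        simp [hS₁, Complex.mem_reProdIm]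
      · simpa [hS₂, Complex.mem_reProdIm] using hxx'
      · exact (convex_reProdIm (convex_Icc _ _) (convex_singleton _)).isPreconnected
    refine ⟨ψ '' (R ∪ S₁ ∪ S₂), ?_, image_mono (subset_union_left.trans subset_union_left) h1R,
      ?_, hSc.image ψ hψc.continuousOn⟩
    · rw [image_union, image_union]
      exact union_subset (union_subset hRU hS₁U) hS₂U
    · refine ⟨x + θ * Complex.I, Or.inr ?_, ?_⟩
      · simpa [hS₂, Complex.mem_reProdIm] using hxx'
      · simp only [hψ]
        rw [← hzexp]

theorem isDomainSet_arcDomain : IsDomainSet arcDomain := ⟨isOpen_arcDomain, isConnected_arcDomain⟩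

/-- The moduli of a connected set form an interval, while just below and just above `exp (ringLog
j)` there are moduli that `diskWithArcs` omits. -/
theorem norm_eq_of_isPreconnected {S : Set ℂ} (hS : IsPreconnected S) (hSE : S ⊆ diskWithArcs)
    {z : ℂ} (hz : z ∈ S) {j : ℕ} (hzj : ‖z‖ = Real.exp (ringLog j)) {w : ℂ} (hw : w ∈ S) :
    ‖w‖ = Real.exp (ringLog j) := by
  have hord : OrdConnected ((fun z : ℂ => ‖z‖) '' S) :=
    (hS.image _ continuous_norm.continuousOn).ordConnected
  have hno : ∀ t : ℝ, 0 < t → (∀ m, t ≠ ringLog m) → Real.exp t ∉ (fun z : ℂ => ‖z‖) '' S := by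
    rintro t ht htm ⟨v, hv, hvt⟩
    simp only at hvt
    rcases mem_diskWithArcs.1 (hSE hv) with h | ⟨m, k, -, h⟩
    · rw [hvt] at h
      exact absurd h (not_le.2 (Real.one_lt_exp_iff.2 ht))
    · rw [norm_of_mem_ringArc h] at hvt
      exact htm m (Real.exp_injective hvt).symm
  by_contra hne
  rcases lt_or_gt_of_ne hne with hlt | hlt
  · obtain ⟨t, ht1, ht2⟩ : ∃ t, max (ringLog (j + 1)) (Real.log (‖w‖)) < t ∧ t < ringLog j := by
      apply exists_between
      refine max_lt (ringLog_strictAnti (Nat.lt_succ_self j)) ?_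
      rcases (norm_nonneg w).eq_or_lt with h0 | h0
      · rw [← h0, Real.log_zero]
        exact ringLog_pos j
      · exact (Real.log_lt_iff_lt_exp h0).2 hlt
    rw [max_lt_iff] at ht1
    refine hno t ((ringLog_pos _).trans ht1.1) (ne_ringLog_of_between ht1.1 ht2) ?_
    refine hord.out ⟨w, hw, rfl⟩ ⟨z, hz, hzj⟩ ⟨?_, (Real.exp_lt_exp.2 ht2).le⟩
    rcases (norm_nonneg w).eq_or_lt with h0 | h0
    · simp only
      rw [← h0]
      exact (Real.exp_pos t).le
    · exact ((Real.log_lt_iff_lt_exp h0).1 ht1.2).le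
  · have hw0 : 0 < ‖w‖ := (Real.exp_pos _).trans hlt
    obtain ⟨t, ht1, ht2⟩ : ∃ t, ringLog j < t ∧ t < min (ringLog j + bumpRadius j)
        (Real.log (‖w‖)) := by
      apply exists_between
      exact lt_min (by linarith [bumpRadius_pos j]) ((Real.lt_log_iff_exp_lt hw0).2 hlt)
    rw [lt_min_iff] at ht2
    refine hno t ((ringLog_pos _).trans ht1) (ne_ringLog_of_lt_add_bumpRadius ht1 ht2.1) ?_
    exact hord.out ⟨z, hz, hzj⟩ ⟨w, hw, rfl⟩
      ⟨(Real.exp_lt_exp.2 ht1).le, ((Real.lt_log_iff_exp_lt hw0).1 ht2.2).le⟩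

theorem subset_ringArc_of_isPreconnected {S : Set ℂ} (hS : IsPreconnected S)
    (hSE : S ⊆ diskWithArcs) {z : ℂ} (hz : z ∈ S) {j k : ℕ} (hk : k < j + 1)
    (hzj : z ∈ ringArc j k) : S ⊆ ringArc j k := by
  refine hS.subset_left_of_isClosed (isCompact_ringArc j k).isClosed
    (v := ⋃ k' ∈ (Finset.range (j + 1)).erase k, ringArc j k') ?_ ?_ ?_ ⟨z, hz, hzj⟩
  · exact isClosed_biUnion_finset fun k' _ => (isCompact_ringArc j k').isClosed
  · simp only [disjoint_iUnion_right, Finset.mem_erase, Finset.mem_range]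
    exact fun k' hk' => disjoint_ringArc hk hk'.2 hk'.1.symm
  · intro w hw
    have hwn := norm_eq_of_isPreconnected hS hSE hz (norm_of_mem_ringArc hzj) hw
    rcases mem_diskWithArcs.1 (hSE hw) with h | ⟨m, k', hk', h⟩
    · rw [hwn] at h
      exact absurd h (not_le.2 (Real.one_lt_exp_iff.2 (ringLog_pos j)))
    · rw [norm_of_mem_ringArc h] at hwn
      obtain rfl : m = j := ringLog_strictAnti.injective (Real.exp_injective hwn)
      by_cases hkk : k' = k
      · exact Or.inl (hkk ▸ h)
      · right
        simp only [mem_iUnion, Finset.mem_erase, Finset.mem_range]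
        exact ⟨k', ⟨hkk, hk'⟩, h⟩

theorem subset_closedBall_of_isPreconnected {S : Set ℂ} (hS : IsPreconnected S)
    (hSE : S ⊆ diskWithArcs) {z : ℂ} (hz : z ∈ S) (hz1 : ‖z‖ ≤ 1) :
    S ⊆ Metric.closedBall 0 1 := by
  intro w hw
  rw [mem_closedBall_zero_iff]
  rcases mem_diskWithArcs.1 (hSE hw) with h | ⟨m, k', hk', h⟩
  · exact h
  · have := norm_eq_of_isPreconnected hS hSE hw (norm_of_mem_ringArc h) hz
    rw [this] at hz1
    exact absurd hz1 (not_le.2 (Real.one_lt_exp_iff.2 (ringLog_pos m)))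

/-- An arc of the `j`-th ring as a subset of the sphere. -/
def sphArc (j k : ℕ) : Set RiemannSphere := (fun z : ℂ => (z : RiemannSphere)) '' ringArc j k

theorem compl_arcDomain :
    arcDomainᶜ = (fun z : ℂ => (z : RiemannSphere)) '' diskWithArcs := compl_compl _

/-- The complement of the domain lies in the plane, which is open in the sphere, so maximality among
connected sets can be tested in `ℂ`. -/
theorem image_coe_mem_complComponents {T : Set ℂ} (hT : IsPreconnected T) (hTE : T ⊆ diskWithArcs)
    {z : ℂ} (hz : z ∈ T) (hmax : ∀ S : Set ℂ, IsPreconnected S → S ⊆ diskWithArcs → z ∈ S → S ⊆ T) :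
    (fun z : ℂ => (z : RiemannSphere)) '' T ∈ complComponents arcDomain := by
  have hzE : (z : RiemannSphere) ∈ arcDomainᶜ := by
    rw [compl_arcDomain]
    exact ⟨z, hTE hz, rfl⟩
  refine ⟨z, hzE, subset_antisymm ?_ ?_⟩
  · refine (hT.image _ OnePoint.continuous_coe.continuousOn).subset_connectedComponentIn
      ⟨z, hz, rfl⟩ ?_
    rw [compl_arcDomain]
    exact image_mono hTE
  · have hsub := connectedComponentIn_subset arcDomainᶜ (z : RiemannSphere)
    rw [compl_arcDomain] at hsub hzE ⊢
    set C := connectedComponentIn ((fun z : ℂ => (z : RiemannSphere)) '' diskWithArcs)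
      (z : RiemannSphere) with hC
    have hCr : C ⊆ range ((↑) : ℂ → OnePoint ℂ) := hsub.trans (image_subset_range _ _)
    have hpre : IsPreconnected (((↑) : ℂ → OnePoint ℂ) ⁻¹' C) :=
      isPreconnected_connectedComponentIn.preimage_of_isOpenMap OnePoint.coe_injective
        OnePoint.isOpenMap_coe hCr
    have := hmax _ hpre (fun w hw => by
      obtain ⟨v, hv, hvw⟩ := hsub hw
      rwa [← OnePoint.coe_injective hvw]) (mem_connectedComponentIn hzE)
    intro y hy
    obtain ⟨w, rfl⟩ := hCr hy
    exact ⟨w, this hy, rfl⟩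

theorem ringArc_nonempty (j k : ℕ) : (ringArc j k).Nonempty :=
  (nonempty_Icc.2 (ringArc_endpoints_lt j k).le).image _

theorem ringArc_subset_diskWithArcs {j k : ℕ} (hk : k < j + 1) : ringArc j k ⊆ diskWithArcs :=
  fun _ hz => mem_diskWithArcs.2 (Or.inr ⟨j, k, hk, hz⟩)

theorem sphArc_mem_complComponents {j k : ℕ} (hk : k < j + 1) :
    sphArc j k ∈ complComponents arcDomain := by
  obtain ⟨z, hz⟩ := ringArc_nonempty j k
  exact image_coe_mem_complComponents (isPreconnected_ringArc j k)
    (ringArc_subset_diskWithArcs hk) hz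
    fun S hS hSE hzS => subset_ringArc_of_isPreconnected hS hSE hzS hk hz

theorem closedUnitDisk_mem_complComponents :
    closedUnitDisk ∈ complComponents arcDomain :=
  image_coe_mem_complComponents (Metric.isPreconnected_closedBall) (fun _ hz => Or.inl hz)
    (z := 0) (by simp)
    fun _ hS hSE hzS => subset_closedBall_of_isPreconnected hS hSE hzS (by simp)

theorem eq_of_mem_complComponents_arcDomain {p : Set RiemannSphere}
    (hp : p ∈ complComponents arcDomain) :
    p = closedUnitDisk ∨ ∃ j k, k < j + 1 ∧ p = sphArc j k := by
  obtain ⟨y, hy⟩ := nonempty_of_mem_complComponents hp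
  have hyE := subset_compl_of_mem_complComponents hp hy
  rw [compl_arcDomain] at hyE
  obtain ⟨z, hz, rfl⟩ := hyE
  rcases mem_diskWithArcs.1 hz with h | ⟨j, k, hk, h⟩
  · refine Or.inl (eq_of_mem_complComponents hp closedUnitDisk_mem_complComponents hy ?_)
    exact ⟨z, mem_closedBall_zero_iff.2 h, rfl⟩
  · exact Or.inr ⟨j, k, hk, eq_of_mem_complComponents hp (sphArc_mem_complComponents hk) hy
      ⟨z, h, rfl⟩⟩

theorem isCircularArc_sphArc {j k : ℕ} (hk : k < j + 1) :
    IsCircularArc (Real.exp (ringLog j)) (sphArc j k) := by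
  refine ⟨_, _, ringArc_endpoints_lt j k, ?_, ?_⟩
  · have h1 := (ringArc_angle_mem hk (left_mem_Icc.2 (ringArc_endpoints_lt j k).le)).1
    have h2 := (ringArc_angle_mem hk (right_mem_Icc.2 (ringArc_endpoints_lt j k).le)).2
    linarith
  · rw [sphArc, ringArc, image_image]
    refine image_congr fun θ _ => ?_
    rw [Complex.exp_add, Complex.ofReal_exp]

/-- The arc has radius at most `e` and angular width at most `2π / (j + 1)`; the spherical distance
costs a factor `π`. -/
theorem sphDiam_sphArc_le (j k : ℕ) :
    sphDiam (sphArc j k) ≤ 2 * Real.pi ^ 2 * Real.exp 1 * (1 / (j + 1)) := by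
  have hpi := Real.pi_pos
  refine sphDiam_le (by positivity) ?_
  rintro _ ⟨_, ⟨θ, hθ, rfl⟩, rfl⟩ _ ⟨_, ⟨τ, hτ, rfl⟩, rfl⟩
  refine (sphDist_coe_le _ _).trans ?_
  have h1 : Complex.exp (ringLog j + θ * Complex.I) - Complex.exp (ringLog j + τ * Complex.I) =
      Complex.exp (ringLog j + τ * Complex.I) * (Complex.exp (Complex.I * (θ - τ : ℝ)) - 1) := by
    rw [mul_sub, ← Complex.exp_add, mul_one]
    congr 2
    push_cast
    ring
  have h2 : ‖(θ - τ : ℝ)‖ ≤ ringStep j := by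
    have := gapWidth_pos j
    rw [Real.norm_eq_abs, abs_le]
    constructor <;> nlinarith [hθ.1, hθ.2, hτ.1, hτ.2]
  have h3 := (Real.norm_exp_I_mul_ofReal_sub_one_le (x := θ - τ)).trans h2
  have h4 := Real.exp_le_exp.2 (ringLog_le_one j)
  simp only
  rw [h1, norm_mul, norm_exp_add_mul_I]
  calc Real.pi * (Real.exp (ringLog j) * ‖Complex.exp (Complex.I * (θ - τ : ℝ)) - 1‖)
      ≤ Real.pi * (Real.exp 1 * ringStep j) := by gcongr
    _ = 2 * Real.pi ^ 2 * Real.exp 1 * (1 / (j + 1)) := by rw [ringStep]; ring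

theorem arcDomain_mem_ellDomains {α : ℝ} (hα : 2 < α) : arcDomain ∈ ellDomains α := by
  classical
  set d : complComponents arcDomain := ⟨closedUnitDisk, closedUnitDisk_mem_complComponents⟩ with hd
  refine ⟨isDomainSet_arcDomain, ?_, ?_⟩
  · refine (((countable_range fun a : ℕ × ℕ => sphArc a.1 a.2).insert closedUnitDisk)).mono ?_
    intro p hp
    rcases eq_of_mem_complComponents_arcDomain hp with h | ⟨j, k, -, h⟩
    · exact Or.inl h
    · exact Or.inr ⟨(j, k), h.symm⟩
  -- One term does not affect summability. The components other than the disk inject into the index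
  -- pairs `(j, k)` with `k ≤ j`.
  · rw [← Finset.summable_compl_iff {d}]
    have hchoice : ∀ p : {p // p ∉ ({d} : Finset (complComponents arcDomain))},
        ∃ a : Σ j : ℕ, Fin (j + 1), (p.1.1 : Set RiemannSphere) = sphArc a.1 a.2 := by
      rintro ⟨⟨p, hp⟩, hpd⟩
      rcases eq_of_mem_complComponents_arcDomain hp with h | ⟨j, k, hk, h⟩
      · exact absurd (Finset.mem_singleton.2 (Subtype.ext h)) hpd
      · exact ⟨⟨j, ⟨k, hk⟩⟩, h⟩
    choose σ hσ using hchoice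
    have hinj : Function.Injective σ := fun p q hpq => by
      apply Subtype.ext
      apply Subtype.ext
      rw [hσ p, hσ q, hpq]
    have hφσ : ((fun p : complComponents arcDomain => sphDiam (p : Set RiemannSphere) ^ α) ∘
        fun p : {p // p ∉ ({d} : Finset (complComponents arcDomain))} => p.1) =
        (fun a : Σ j : ℕ, Fin (j + 1) => sphDiam (sphArc a.1 a.2) ^ α) ∘ σ := by
      funext p
      simp only [Function.comp_apply]
      rw [← hσ p]
    change Summable ((fun p : complComponents arcDomain => sphDiam (p : Set RiemannSphere) ^ α) ∘
        fun p : {p // p ∉ ({d} : Finset (complComponents arcDomain))} => p.1)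
    rw [hφσ]
    refine Summable.comp_injective ?_ hinj
    set C := 2 * Real.pi ^ 2 * Real.exp 1 with hC
    have hpi := Real.pi_pos
    have hC0 : 0 ≤ C := by positivity
    have hbase : Summable fun a : Σ j : ℕ, Fin (j + 1) => (C * (1 / ((a.1 : ℝ) + 1))) ^ α := by
      rw [summable_sigma_of_nonneg fun a => by positivity]
      refine ⟨fun j => (hasSum_fintype _).summable, ?_⟩
      -- The `j + 1` arcs of a ring lower the exponent by one; `α > 2` is what makes `α - 1 > 1`.
      have h1 : ∀ j : ℕ, ∑' _ : Fin (j + 1), (C * (1 / ((j : ℝ) + 1))) ^ α =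
          C ^ α * (1 / ((j + 1 : ℕ) : ℝ) ^ (α - 1)) := by
        intro j
        rw [tsum_fintype, Finset.sum_const, Finset.card_univ, Fintype.card_fin, nsmul_eq_mul,
          Real.mul_rpow hC0 (by positivity), Real.div_rpow zero_le_one (by positivity),
          Real.one_rpow, Real.rpow_sub (by positivity), Real.rpow_one]
        push_cast
        have : (j : ℝ) + 1 ≠ 0 := by positivity
        have : ((j : ℝ) + 1) ^ α ≠ 0 := by positivity
        field_simp
      simp_rw [h1]
      refine Summable.mul_left _ ?_
      exact (summable_nat_add_iff 1).2 (Real.summable_one_div_nat_rpow.2 (by linarith))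
    refine Summable.of_nonneg_of_le (fun a => ?_) (fun a => ?_) hbase
    · exact Real.rpow_nonneg (sphDiam_nonneg _) _
    · exact Real.rpow_le_rpow (sphDiam_nonneg _) (sphDiam_sphArc_le a.1 a.2) (by linarith)

theorem closedUnitDisk_mem_nontrivialComponents :
    closedUnitDisk ∈ nontrivialComponents arcDomain := by
  refine ⟨closedUnitDisk_mem_complComponents, ?_⟩
  by_contra h
  have := not_sphDiam_pos_iff.1 h (x := ((0 : ℂ) : RiemannSphere)) ⟨0, by simp, rfl⟩
    (y := ((1 : ℂ) : RiemannSphere)) ⟨1, by simp, rfl⟩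
  rw [OnePoint.coe_eq_coe] at this
  exact zero_ne_one this

end

end RiemannSphere

/-! ### Crosscuts around the gaps, and separation of the disk from infinity. -/

theorem Metric.dist_le_of_mem_closure {X : Type*} [PseudoMetricSpace X] {s : Set X} {l : ℝ}
    (h : ∀ x ∈ s, ∀ y ∈ s, dist x y ≤ l) {x y : X} (hx : x ∈ closure s) (hy : y ∈ closure s) :
    dist x y ≤ l := by
  have h1 : ∀ x ∈ s, dist x y ≤ l := fun x hx => by
    have := closure_minimal (fun z hz => by
      rw [mem_closedBall, dist_comm]
      exact h x hx z hz : s ⊆ closedBall x l) isClosed_closedBall hy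
    rwa [mem_closedBall, dist_comm] at this
  exact closure_minimal (fun z hz => mem_closedBall.2 (h1 z hz)) isClosed_closedBall hx

/-- A limit of images of points of `c` is the image of a point of the closure of `c`. -/
theorem exists_mem_closure_of_tendsto {X Y ι : Type*} [TopologicalSpace X] [CompactSpace X]
    [TopologicalSpace Y] [T2Space Y] {Ψ : X → Y} (hΨ : Continuous Ψ) {F : Filter ι} [F.NeBot]
    {u : ι → X} {c : Set X} (hu : ∀ᶠ i in F, u i ∈ c) {y : Y}
    (hy : Tendsto (fun i => Ψ (u i)) F (𝓝 y)) : ∃ x ∈ closure c, Ψ x = y := by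
  obtain ⟨x, hx⟩ := exists_clusterPt_of_compactSpace (map u F)
  refine ⟨x, ?_, ?_⟩
  · rw [mem_closure_iff_clusterPt]
    exact hx.mono (le_principal_iff.2 hu)
  · have h1 : ClusterPt (Ψ x) (map Ψ (map u F)) := hx.map hΨ.continuousAt tendsto_map
    rw [map_map] at h1
    have : (𝓝 (Ψ x) ⊓ 𝓝 y).NeBot := h1.neBot.mono (inf_le_inf_left _ hy)
    exact eq_of_nhds_neBot this

namespace RiemannSphere

/-- The finite part is a translate of the exponential of a half-plane, and `∞` is in its closure. -/
theorem isPreconnected_compl_image_closedBall {b : ℂ} {T : ℝ} (hT : 0 ≤ T) :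
    IsPreconnected ((fun z : ℂ => (z : RiemannSphere)) '' Metric.closedBall b T)ᶜ := by
  set H : Set ℂ := {w | T < Real.exp w.re} with hH
  have hHc : IsPreconnected H := by
    have : H = Complex.reLm ⁻¹' {x | T < Real.exp x} := rfl
    rw [this]
    refine Convex.isPreconnected (Convex.linear_preimage (OrdConnected.convex ?_) _)
    exact ⟨fun x hx y _ z hz => lt_of_lt_of_le hx (Real.exp_le_exp.2 hz.1)⟩
  set ψ : ℂ → RiemannSphere := fun w => (b + Complex.exp w : ℂ) with hψ
  have hψc : Continuous ψ :=
    OnePoint.continuous_coe.comp (continuous_const.add Complex.continuous_exp)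
  have himg : ((fun z : ℂ => (z : RiemannSphere)) '' Metric.closedBall b T)ᶜ =
      insert OnePoint.infty (ψ '' H) := by
    ext x
    induction x using OnePoint.rec with
    | infty => simp
    | coe z =>
      rw [mem_compl_iff, OnePoint.coe_injective.mem_set_image, mem_insert_iff,
        or_iff_right (OnePoint.coe_ne_infty z), Metric.mem_closedBall, not_le, dist_eq_norm]
      constructor
      · intro h
        have h0 : z - b ≠ 0 := by
          rw [← norm_pos_iff]
          linarith
        refine ⟨Complex.log (z - b), ?_, ?_⟩
        · change T < Real.exp (Complex.log (z - b)).re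
          rw [← Complex.norm_exp, Complex.exp_log h0]
          exact h
        · simp only [hψ]
          rw [Complex.exp_log h0, add_sub_cancel]
      · rintro ⟨w, hw, hwz⟩
        rw [← OnePoint.coe_injective hwz, add_sub_cancel_left, Complex.norm_exp]
        exact hw
  rw [himg]
  refine (hHc.image ψ hψc.continuousOn).subset_closure (subset_insert _ _)
    (insert_subset ?_ subset_closure)
  have hlim : Tendsto (fun t : ℝ => ψ t) atTop (𝓝 OnePoint.infty) := by
    refine OnePoint.tendsto_coe_infty.comp ?_
    rw [coclosedCompact_eq_cocompact, ← Metric.cobounded_eq_cocompact]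
    refine (tendsto_const_add_cobounded b).comp ?_
    rw [← tendsto_norm_atTop_iff_cobounded]
    have : (fun t : ℝ => ‖Complex.exp t‖) = Real.exp := by
      funext t
      simp [Complex.norm_exp]
    rw [this]
    exact Real.tendsto_exp_atTop
  refine mem_closure_of_tendsto hlim ?_
  filter_upwards [Real.tendsto_exp_atTop.eventually_gt_atTop T] with t ht
  exact ⟨t, by simpa [hH] using ht, rfl⟩

noncomputable section

/-- The midpoint, in logarithmic coordinates, of the `k`-th gap of the `j`-th ring. -/
def gapCenter (j k : ℕ) : ℂ := ringLog j + (k * ringStep j : ℝ) * Complex.I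

/-- Logarithmic coordinates centred at the `k`-th gap of the `j`-th ring. -/
def gapChart (j k : ℕ) (w : ℂ) : ℂ := Complex.exp (gapCenter j k + Complex.exp w)

/-- The coordinate rectangle that parametrizes the outer half of a neighbourhood of a gap. -/
def gapRect (j : ℕ) : Set ℂ :=
  Ioo (Real.log (gapWidth j)) (Real.log (bumpRadius j)) ×ℂ Ioo (-(Real.pi / 2)) (Real.pi / 2)

theorem gapCenter_add (j k : ℕ) (v : ℂ) : gapCenter j k + v =
    (ringLog j + v.re : ℝ) + (k * ringStep j + v.im : ℝ) * Complex.I := by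
  apply Complex.ext <;> simp [gapCenter]

theorem exp_mem_Ioo_of_mem_Ioo_log {j : ℕ} {s : ℝ}
    (hs : s ∈ Ioo (Real.log (gapWidth j)) (Real.log (bumpRadius j))) :
    gapWidth j < Real.exp s ∧ Real.exp s < bumpRadius j :=
  ⟨(Real.log_lt_iff_lt_exp (gapWidth_pos j)).1 hs.1,
    (Real.lt_log_iff_exp_lt (bumpRadius_pos j)).1 hs.2⟩

/-- The width of the coordinate rectangle of a gap; the gaps were chosen so narrow in order to make
it this large. -/
theorem log_bumpRadius_sub_log_gapWidth (j : ℕ) :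
    Real.log (bumpRadius j) - Real.log (gapWidth j) = (j + 1) ^ 4 := by
  rw [gapWidth, Real.log_mul (bumpRadius_pos j).ne' (Real.exp_pos _).ne', Real.log_exp]
  ring

theorem norm_exp_lt_of_mem_gapRect {j : ℕ} {w : ℂ} (hw : w ∈ gapRect j) :
    ‖Complex.exp w‖ < bumpRadius j := by
  rw [Complex.norm_exp]
  exact (exp_mem_Ioo_of_mem_Ioo_log hw.1).2

theorem re_exp_pos_of_mem_gapRect {j : ℕ} {w : ℂ} (hw : w ∈ gapRect j) :
    0 < (Complex.exp w).re := by
  rw [Complex.exp_re]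
  exact mul_pos (Real.exp_pos _) (Real.cos_pos_of_mem_Ioo hw.2)

/-- On the outer half of a gap neighbourhood the modulus lies strictly between ring `j` and the next
larger ring. -/
theorem gapChart_mem_arcDomain {j k : ℕ} {w : ℂ} (hw : w ∈ gapRect j) :
    (gapChart j k w : RiemannSphere) ∈ arcDomain := by
  have h1 := re_exp_pos_of_mem_gapRect hw
  have h2 := (Complex.re_le_norm _).trans_lt (norm_exp_lt_of_mem_gapRect hw)
  rw [gapChart, gapCenter_add]
  refine exp_mem_arcDomain_of_ne (by linarith [ringLog_pos j])
    (ne_ringLog_of_lt_add_bumpRadius (j := j) ?_ ?_) <;> linarith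

theorem norm_gapChart_le {j k : ℕ} {w : ℂ} (hw : w ∈ gapRect j) :
    ‖gapChart j k w‖ ≤ Real.exp 2 := by
  have h2 := (Complex.re_le_norm _).trans_lt (norm_exp_lt_of_mem_gapRect hw)
  rw [gapChart, gapCenter_add, norm_exp_add_mul_I, Real.exp_le_exp]
  linarith [ringLog_le_one j, bumpRadius_le_half j]

/-- The inner exponentials have modulus below `1 / 2`, too small to differ by a nonzero multiple of
`2πi`; the height `π` of the rectangle makes the inner exponential injective. -/
theorem injOn_gapChart (j k : ℕ) : InjOn (gapChart j k) (gapRect j) := by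
  intro w hw v hv h
  have hpi := Real.pi_gt_three
  obtain ⟨n, hn⟩ := Complex.exp_eq_exp_iff_exists_int.1 h
  have h1 := norm_exp_lt_of_mem_gapRect hw
  have h2 := norm_exp_lt_of_mem_gapRect hv
  have h3 := bumpRadius_le_half j
  have h4 : Complex.exp w - Complex.exp v = n * (2 * Real.pi * Complex.I) := by
    linear_combination hn
  have h5 : |(n : ℝ)| * (2 * Real.pi) < 1 := by
    have h6 : ‖(n * (2 * Real.pi * Complex.I) : ℂ)‖ = |(n : ℝ)| * (2 * Real.pi) := by
      rw [norm_mul, norm_mul, norm_mul, Complex.norm_I, Complex.norm_real, Complex.norm_intCast,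
        Real.norm_eq_abs, abs_of_pos Real.pi_pos]
      simp
    rw [← h6, ← h4]
    exact (norm_sub_le _ _).trans_lt (by linarith)
  have hn0 : n = 0 := by
    have : |(n : ℝ)| < 1 := by nlinarith [abs_nonneg (n : ℝ)]
    rw [← Int.cast_abs] at this
    have : |n| < 1 := by exact_mod_cast this
    exact Int.abs_lt_one_iff.1 this
  rw [hn0, Int.cast_zero, zero_mul, sub_eq_zero] at h4
  refine Complex.exp_inj_of_neg_pi_lt_of_le_pi ?_ ?_ ?_ ?_ h4
  · linarith [hw.2.1]
  · linarith [hw.2.2]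
  · linarith [hv.2.1]
  · linarith [hv.2.2]

theorem differentiable_gapChart (j k : ℕ) : Differentiable ℂ (gapChart j k) := by
  unfold gapChart
  fun_prop

/-- The crosscuts around gap `k` end on arc `k` at the top: their radius exceeds the half-width of
the gap and is less than half the angular step. -/
theorem gapChart_pi_div_two_mem {j k : ℕ} {s : ℝ}
    (hs : s ∈ Ioo (Real.log (gapWidth j)) (Real.log (bumpRadius j))) :
    gapChart j k (s + (Real.pi / 2 : ℝ) * Complex.I) ∈ ringArc j k := by
  obtain ⟨h1, h2⟩ := exp_mem_Ioo_of_mem_Ioo_log hs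
  have h3 := two_mul_bumpRadius_lt_ringStep j
  have h4 := gapWidth_lt_bumpRadius j
  rw [gapChart, gapCenter_add, exp_mem_ringArc_iff]
  refine ⟨?_, 0, ?_⟩
  · simp [Complex.exp_re]
  · have : (Complex.exp (s + (Real.pi / 2 : ℝ) * Complex.I)).im = Real.exp s := by
      simp [Complex.exp_im]
    rw [this]
    constructor <;> simp only [Int.cast_zero] <;> linarith

/-- At the bottom the crosscuts around gap `k + 1` end on arc `k`, which links consecutive arcs into
a chain. -/
theorem gapChart_neg_pi_div_two_mem {j k : ℕ} {s : ℝ}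
    (hs : s ∈ Ioo (Real.log (gapWidth j)) (Real.log (bumpRadius j))) :
    gapChart j (k + 1) (s + (-(Real.pi / 2) : ℝ) * Complex.I) ∈ ringArc j k := by
  obtain ⟨h1, h2⟩ := exp_mem_Ioo_of_mem_Ioo_log hs
  have h3 := two_mul_bumpRadius_lt_ringStep j
  have h4 := gapWidth_lt_bumpRadius j
  rw [gapChart, gapCenter_add, exp_mem_ringArc_iff]
  refine ⟨?_, 0, ?_⟩
  · simp [Complex.exp_re]
  · have : (Complex.exp (s + (-(Real.pi / 2) : ℝ) * Complex.I)).im = -Real.exp s := by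
      simp [Complex.exp_im]
    rw [this]
    push_cast
    constructor <;> linarith

/-- The crosscut at distance `exp s` around the `k`-th gap of the `j`-th ring. -/
def crosscut (j k : ℕ) (s : ℝ) : Set ℂ :=
  (fun φ : ℝ => gapChart j k (s + φ * Complex.I)) '' Ioo (-(Real.pi / 2)) (Real.pi / 2)

theorem add_mul_I_mem_gapRect {j : ℕ} {s φ : ℝ}
    (hs : s ∈ Ioo (Real.log (gapWidth j)) (Real.log (bumpRadius j)))
    (hφ : φ ∈ Ioo (-(Real.pi / 2)) (Real.pi / 2)) : (s + φ * Complex.I : ℂ) ∈ gapRect j := by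
  simpa [gapRect, Complex.mem_reProdIm] using ⟨hs, hφ⟩

/-- The points of the circle carrying the `j`-th ring lie on an arc or in a gap. -/
theorem mem_ringArc_or_near_gap {j : ℕ} {z : ℂ} (hz : ‖z‖ = Real.exp (ringLog j)) :
    (∃ k < j + 1, z ∈ ringArc j k) ∨
      ∃ k < j + 1, ∃ t : ℝ, |t| < gapWidth j ∧ z = Complex.exp (gapCenter j k + t * Complex.I) := by
  have hs := ringStep_pos j
  have hη := gapWidth_pos j
  have hz0 : z ≠ 0 := by
    rw [← norm_pos_iff, hz]
    exact Real.exp_pos _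
  have hpi := Real.two_pi_pos
  set θ := toIcoMod hpi 0 (Complex.log z).im with hθ
  have hθm := toIcoMod_mem_Ico hpi 0 (Complex.log z).im
  rw [← hθ, zero_add] at hθm
  have hzθ : z = Complex.exp (ringLog j + θ * Complex.I) := by
    conv_lhs => rw [← Complex.exp_log hz0]
    refine Complex.exp_eq_exp_iff_exists_int.2 ⟨toIcoDiv hpi 0 (Complex.log z).im, ?_⟩
    have h1 := toIcoMod_add_toIcoDiv_zsmul hpi 0 (Complex.log z).im
    rw [← hθ, zsmul_eq_mul] at h1
    have h2 : (Complex.log z).re = ringLog j := by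
      rw [Complex.log_re, hz, Real.log_exp]
    generalize toIcoDiv hpi 0 (Complex.log z).im = n at h1 ⊢
    generalize Complex.log z = u at h1 h2 ⊢
    apply Complex.ext
    · simp [h2]
    · simp [← h1]
  set k := ⌊θ / ringStep j⌋₊ with hk
  have hk1 : k * ringStep j ≤ θ := by
    rw [← le_div_iff₀ hs]
    exact Nat.floor_le (div_nonneg hθm.1 hs.le)
  have hk2 : θ < (k + 1) * ringStep j := by
    rw [← div_lt_iff₀ hs]
    exact Nat.lt_floor_add_one _
  have hkj : k < j + 1 := by
    have : (k : ℝ) * ringStep j < ((j + 1 : ℕ) : ℝ) * ringStep j := by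
      push_cast
      rw [ringStep_mul]
      linarith [hθm.2]
    exact_mod_cast lt_of_mul_lt_mul_right this hs.le
  by_cases h1 : θ < k * ringStep j + gapWidth j
  · refine Or.inr ⟨k, hkj, θ - k * ringStep j, ?_, ?_⟩
    · rw [abs_lt]
      constructor <;> linarith
    · rw [hzθ, gapCenter]
      congr 1
      push_cast
      ring
  · by_cases h2 : (k + 1) * ringStep j - gapWidth j < θ
    · right
      have habs : |θ - (k + 1) * ringStep j| < gapWidth j := by
        rw [abs_lt]
        constructor <;> linarith
      rcases Nat.lt_or_ge (k + 1) (j + 1) with h3 | h3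
      · refine ⟨k + 1, h3, θ - (k + 1) * ringStep j, habs, ?_⟩
        rw [hzθ, gapCenter]
        congr 1
        push_cast
        ring
      -- The gap after the last arc is gap `0`, one full turn later.
      · have hkj' : k = j := by omega
        rw [hkj', ringStep_mul] at habs
        refine ⟨0, Nat.succ_pos _, θ - 2 * Real.pi, habs, ?_⟩
        rw [hzθ, gapCenter]
        refine Complex.exp_eq_exp_iff_exists_int.2 ⟨1, ?_⟩
        push_cast
        ring
    · refine Or.inl ⟨k, hkj, ?_⟩
      rw [hzθ]
      exact ⟨θ, ⟨not_lt.1 h1, not_lt.1 h2⟩, rfl⟩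

/-- A ring of arcs together with crosscuts around its gaps separates the disk from infinity. -/
theorem exists_separation (j : ℕ) (s : ℕ → ℝ)
    (hs : ∀ k, s k ∈ Ioo (Real.log (gapWidth j)) (Real.log (bumpRadius j))) :
    ∃ I E : Set RiemannSphere, IsOpen I ∧ IsOpen E ∧ Disjoint I E ∧
      IsSaturated arcDomain I ∧ IsSaturated arcDomain E ∧
      closedUnitDisk ⊆ I ∧ OnePoint.infty ∈ E ∧
      ∀ x, x ∈ I ∨ x ∈ E ∨ ∃ k < j + 1, x ∈ sphArc j k ∨
        ∃ z ∈ crosscut j k (s k), x = (z : RiemannSphere) := by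
  set ρ : ℕ → ℝ := fun k => Real.exp (s k) with hρ
  have hρη : ∀ k, gapWidth j < ρ k := fun k => (exp_mem_Ioo_of_mem_Ioo_log (hs k)).1
  have hρδ : ∀ k, ρ k < bumpRadius j := fun k => (exp_mem_Ioo_of_mem_Ioo_log (hs k)).2
  set A : Set ℂ := ⋃ k ∈ Finset.range (j + 1), ringArc j k with hA
  have hAcl : IsClosed A := isClosed_biUnion_finset fun k _ => (isCompact_ringArc j k).isClosed
  have hAn : ∀ z ∈ A, ‖z‖ = Real.exp (ringLog j) := by
    intro z hz
    simp only [hA, mem_iUnion] at hz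
    obtain ⟨k, -, hk⟩ := hz
    exact norm_of_mem_ringArc hk
  set B : Set ℂ := ⋃ k ∈ Finset.range (j + 1),
    Complex.exp '' Metric.ball (gapCenter j k) (ρ k) with hB
  set B' : Set ℂ := ⋃ k ∈ Finset.range (j + 1),
    Complex.exp '' Metric.closedBall (gapCenter j k) (ρ k) with hB'
  have hBB' : B ⊆ B' :=
    iUnion₂_mono fun k _ => image_mono Metric.ball_subset_closedBall
  have hBo : IsOpen B := isOpen_biUnion fun k _ => Complex.isOpenMap_exp _ Metric.isOpen_ball
  have hB'c : IsCompact B' := (Finset.range (j + 1)).isCompact_biUnion fun k _ =>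
    (isCompact_closedBall _ _).image Complex.continuous_exp
  have hB'n : ∀ z ∈ B', ‖z‖ < Real.exp (ringLog j + bumpRadius j) := by
    intro z hz
    simp only [hB', mem_iUnion] at hz
    obtain ⟨k, -, w, hw, rfl⟩ := hz
    rw [Complex.norm_exp, Real.exp_lt_exp]
    have h1 : w.re - ringLog j = (w - gapCenter j k).re := by simp [gapCenter]
    have h2 := (Complex.re_le_norm (w - gapCenter j k)).trans (mem_closedBall_iff_norm.1 hw)
    linarith [hρδ k]
  set D : Set ℂ := Metric.closedBall 0 (Real.exp (ringLog j)) with hD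
  -- The inner side is the disk bounded by the ring, bulging out through each gap as far as the
  -- crosscut. The bulges use full balls around the gap centres; their inner halves change nothing.
  set I₀ : Set ℂ := (Metric.ball 0 (Real.exp (ringLog j)) ∪ B) \ A with hI₀
  set I : Set RiemannSphere := (fun z : ℂ => (z : RiemannSphere)) '' I₀ with hI
  set E : Set RiemannSphere := ((fun z : ℂ => (z : RiemannSphere)) '' (D ∪ B'))ᶜ with hE
  have hI₀D : I₀ ⊆ D ∪ B' := sdiff_subset.trans
    (union_subset_union Metric.ball_subset_closedBall hBB')
  have hIE : Disjoint I E := disjoint_compl_right_iff_subset.2 (image_mono hI₀D)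
  have hring : ∀ {i k : ℕ}, k < i + 1 → i < j → sphArc i k ⊆ E := by
    rintro i k - hij _ ⟨z, hz, rfl⟩ hz'
    rw [OnePoint.coe_injective.mem_set_image] at hz'
    have hzn := norm_of_mem_ringArc hz
    have h1 := ringLog_add_bumpRadius_lt hij
    have h2 := bumpRadius_pos j
    rcases hz' with h | h
    · rw [hD, mem_closedBall_zero_iff, hzn, Real.exp_le_exp] at h
      linarith
    · have := hB'n z h
      rw [hzn, Real.exp_lt_exp] at this
      linarith
  have hdiskI : closedUnitDisk ⊆ I := by
    rintro _ ⟨z, hz, rfl⟩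
    rw [mem_closedBall_zero_iff] at hz
    have h1 : ‖z‖ < Real.exp (ringLog j) :=
      hz.trans_lt (Real.one_lt_exp_iff.2 (ringLog_pos j))
    exact ⟨z, ⟨Or.inl (mem_ball_zero_iff.2 h1), fun h => h1.ne (hAn z h)⟩, rfl⟩
  -- Larger rings lie outside, smaller rings and the disk inside, and the arcs of ring `j` belong to
  -- neither side.
  have hclass : ∀ p ∈ complComponents arcDomain, p ⊆ I ∨ p ⊆ E ∨ (Disjoint p I ∧ Disjoint p E) := by
    intro p hp
    rcases eq_of_mem_complComponents_arcDomain hp with rfl | ⟨i, k, hk, rfl⟩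
    · exact Or.inl hdiskI
    · rcases lt_trichotomy i j with h | rfl | h
      · exact Or.inr (Or.inl (hring hk h))
      · refine Or.inr (Or.inr ⟨?_, ?_⟩)
        · rw [disjoint_left]
          rintro _ ⟨z, hz, rfl⟩ hz'
          rw [hI, OnePoint.coe_injective.mem_set_image] at hz'
          refine hz'.2 ?_
          simp only [hA, mem_iUnion]
          exact ⟨k, Finset.mem_range.2 hk, hz⟩
        · rw [disjoint_left]
          rintro _ ⟨z, hz, rfl⟩ hz'
          refine hz' ⟨z, Or.inl ?_, rfl⟩
          rw [hD, mem_closedBall_zero_iff]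
          exact (norm_of_mem_ringArc hz).le
      · left
        rintro _ ⟨z, hz, rfl⟩
        have h1 : ‖z‖ < Real.exp (ringLog j) := by
          rw [norm_of_mem_ringArc hz]
          exact Real.exp_lt_exp.2 (ringLog_strictAnti h)
        exact ⟨z, ⟨Or.inl (mem_ball_zero_iff.2 h1), fun h => h1.ne (hAn z h)⟩, rfl⟩
  refine ⟨I, E, ?_, ?_, hIE, ?_, ?_, hdiskI, ?_, ?_⟩
  · exact OnePoint.isOpen_image_coe.2 ((Metric.isOpen_ball.union hBo).sdiff hAcl)
  · rw [hE, isOpen_compl_iff]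
    have : IsCompact (D ∪ B') := (isCompact_closedBall _ _).union hB'c
    exact OnePoint.isClosed_image_coe.2 ⟨this.isClosed, this⟩
  · rintro p hp ⟨x, hxp, hxI⟩
    rcases hclass p hp with h | h | h
    · exact h
    · exact absurd (h hxp) (disjoint_left.1 hIE hxI)
    · exact absurd hxI (disjoint_left.1 h.1 hxp)
  · rintro p hp ⟨x, hxp, hxE⟩
    rcases hclass p hp with h | h | h
    · exact absurd hxE (disjoint_left.1 hIE (h hxp))
    · exact h
    · exact absurd hxE (disjoint_left.1 h.2 hxp)
  · rintro ⟨z, -, hz⟩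
    exact OnePoint.coe_ne_infty z hz
  · intro x
    by_cases hxE : x ∈ E
    · exact Or.inr (Or.inl hxE)
    rw [hE, mem_compl_iff, not_not] at hxE
    obtain ⟨z, hz, rfl⟩ := hxE
    by_cases hzA : z ∈ A
    · simp only [hA, mem_iUnion, Finset.mem_range] at hzA
      obtain ⟨k, hk, hzk⟩ := hzA
      exact Or.inr (Or.inr ⟨k, hk, Or.inl ⟨z, hzk, rfl⟩⟩)
    by_cases hzB : z ∈ B
    · exact Or.inl ⟨z, ⟨Or.inr hzB, hzA⟩, rfl⟩
    rcases lt_trichotomy ‖z‖ (Real.exp (ringLog j)) with h | h | h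
    · exact Or.inl ⟨z, ⟨Or.inl (mem_ball_zero_iff.2 h), hzA⟩, rfl⟩
    · exfalso
      rcases mem_ringArc_or_near_gap h with ⟨k, hk, hzk⟩ | ⟨k, hk, t, ht, hzt⟩
      · apply hzA
        simp only [hA, mem_iUnion, Finset.mem_range]
        exact ⟨k, hk, hzk⟩
      · apply hzB
        simp only [hB, mem_iUnion, Finset.mem_range]
        refine ⟨k, hk, _, ?_, hzt.symm⟩
        rw [mem_ball_iff_norm, add_sub_cancel_left, norm_mul, Complex.norm_I, mul_one,
          Complex.norm_real]
        exact ht.trans (hρη k)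
    · have hzB' : z ∈ B' := by
        refine hz.resolve_left fun h' => ?_
        rw [hD, mem_closedBall_zero_iff] at h'
        linarith
      simp only [hB', mem_iUnion, Finset.mem_range] at hzB'
      obtain ⟨k, hk, w, hw, rfl⟩ := hzB'
      refine Or.inr (Or.inr ⟨k, hk, Or.inr ⟨_, ?_, rfl⟩⟩)
      set v := w - gapCenter j k with hv
      have hvn : ‖v‖ = ρ k := by
        refine le_antisymm (mem_closedBall_iff_norm.1 hw) (not_lt.1 fun hlt => hzB ?_)
        simp only [hB, mem_iUnion, Finset.mem_range]
        exact ⟨k, hk, w, mem_ball_iff_norm.2 hlt, rfl⟩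
      -- A remaining point outside the circle of the ring is on the outer half of a bounding circle,
      -- which is the crosscut itself.
      have hvre : 0 < v.re := by
        rw [Complex.norm_exp, Real.exp_lt_exp] at h
        simp [hv, gapCenter, h]
      refine ⟨Complex.arg v, abs_lt.1 (Complex.abs_arg_lt_pi_div_two_iff.2 (Or.inl hvre)), ?_⟩
      simp only [gapChart]
      have : Complex.exp (s k + Complex.arg v * Complex.I) = v := by
        rw [Complex.exp_add, ← Complex.ofReal_exp]
        change ((ρ k : ℝ) : ℂ) * _ = v
        rw [← hvn, Complex.norm_mul_exp_arg_mul_I]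
      rw [this, hv, add_sub_cancel]

end

end RiemannSphere

/-! ### Area against length: the unit disk shrinks to a point. -/

namespace RiemannSphere

noncomputable section

/-- Disjoint disks in a bounded set have square summable radii. -/
theorem sum_sq_radius_le {ι : Type*} (s : Finset ι) {c : ι → ℂ} {r : ι → ℝ}
    (hr : ∀ i ∈ s, 0 ≤ r i)
    (hd : (s : Set ι).PairwiseDisjoint fun i => Metric.closedBall (c i) (r i)) {K : Set ℂ}
    (hK : IsCompact K) (hsub : ∀ i ∈ s, Metric.closedBall (c i) (r i) ⊆ K) :
    ∑ i ∈ s, r i ^ 2 ≤ (volume K).toReal := by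
  have h1 : ∑ i ∈ s, volume (Metric.closedBall (c i) (r i)) ≤ volume K := by
    rw [← measure_biUnion_finset hd fun i _ => Metric.isClosed_closedBall.measurableSet]
    exact measure_mono (iUnion₂_subset hsub)
  have h2 : ∑ i ∈ s, ENNReal.ofReal (r i ^ 2) ≤ volume K := by
    refine (Finset.sum_le_sum fun i hi => ?_).trans h1
    rw [Complex.volume_closedBall, ENNReal.ofReal_pow (hr i hi)]
    -- The factor `π ≥ 1` in the area of a disk is discarded.
    refine le_mul_of_one_le_right' ?_
    rw [← ENNReal.coe_one, ENNReal.coe_le_coe]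
    rw [← NNReal.coe_le_coe, NNReal.coe_one, NNReal.coe_real_pi]
    linarith [Real.pi_gt_three]
  rw [← ENNReal.ofReal_sum_of_nonneg fun i _ => sq_nonneg (r i)] at h2
  rw [← ENNReal.ofReal_le_iff_le_toReal hK.measure_lt_top.ne]
  exact h2

/-- By Cauchy–Schwarz over the `j + 1` terms of ring `j`, a lower bound on the sum of radii gives
one of order `1 / (j + 1)` on the sum of squares. -/
theorem not_exists_bound_of_ring_sums {r : ℕ → ℕ → ℝ} {A C d : ℝ} (hd : 0 < d)
    (hsum : ∀ n, ∑ j ∈ Finset.range n, ∑ k ∈ Finset.range (j + 1), r j k ^ 2 ≤ A)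
    (hle : ∀ j : ℕ, d ≤ 4 * ∑ k ∈ Finset.range (j + 1), r j k + C / (j + 1)) : False := by
  set a : ℕ → ℝ := fun j => ∑ k ∈ Finset.range (j + 1), r j k ^ 2 with ha
  have hsa : Summable a := summable_of_sum_range_le
    (fun j => Finset.sum_nonneg fun k _ => sq_nonneg _) hsum
  have hlim : Tendsto (fun j : ℕ => C / ((j : ℝ) + 1)) atTop (𝓝 0) := by
    have := tendsto_one_div_add_atTop_nhds_zero_nat (𝕜 := ℝ) |>.const_mul C
    simpa [div_eq_mul_inv] using this
  -- Once `C / (j + 1) < d / 2`, the radii of the ring sum to at least `d / 8`.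
  have hev : ∀ᶠ j : ℕ in atTop, (d / 8) ^ 2 * (1 / ((j : ℝ) + 1)) ≤ a j := by
    filter_upwards [hlim.eventually_lt_const (half_pos hd)] with j hj
    have h1 : d / 8 ≤ ∑ k ∈ Finset.range (j + 1), r j k := by linarith [hle j]
    have h2 := sq_sum_le_card_mul_sum_sq (s := Finset.range (j + 1)) (f := fun k => r j k)
    rw [Finset.card_range] at h2
    push_cast at h2
    rw [mul_one_div, div_le_iff₀ (by positivity)]
    nlinarith [mul_self_le_mul_self (by positivity) h1]
  have hs : Summable fun j : ℕ => (d / 8) ^ 2 * (1 / ((j : ℝ) + 1)) := by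
    refine Summable.of_norm_bounded_eventually_nat hsa ?_
    filter_upwards [hev] with j hj
    rwa [Real.norm_of_nonneg (by positivity)]
  rw [summable_mul_left_iff (by positivity)] at hs
  have h3 : Summable fun j : ℕ => 1 / ((j + 1 : ℕ) : ℝ) := by simpa using hs
  exact Real.not_summable_one_div_natCast ((summable_nat_add_iff 1).1 h3)

theorem isSaturated_of_subset {U V : Set RiemannSphere} (h : V ⊆ U) : IsSaturated U V := by
  rintro p hp ⟨x, hxp, hxV⟩
  exact absurd (h hxV) (subset_compl_of_mem_complComponents hp hxp)

/-- Only a bounded part of the image corresponds to a bounded part of the domain. -/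
theorem exists_compact_of_fiber {Ψ : RiemannSphere → Hat arcDomain} (hΨ : Continuous Ψ)
    (hinf : ∀ y, Ψ y = proj arcDomain OnePoint.infty ↔ y = OnePoint.infty) :
    ∃ K : Set ℂ, IsCompact K ∧ ∀ z : ℂ, ‖z‖ ≤ Real.exp 2 → ∀ y, Ψ y = proj arcDomain z →
      y ∈ (fun z : ℂ => (z : RiemannSphere)) '' K := by
  set D : Set RiemannSphere := (fun z : ℂ => (z : RiemannSphere)) ''
    Metric.closedBall 0 (Real.exp 2) with hD
  have hDc : IsClosed D := OnePoint.isClosed_image_coe.2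
    ⟨Metric.isClosed_closedBall, isCompact_closedBall _ _⟩
  -- All arcs have modulus at most `e`; the radius `exp 2` also leaves room for the gap
  -- neighbourhoods.
  have hDU : Dᶜ ⊆ arcDomain := by
    refine compl_subset_compl.2 (image_mono fun z hz => ?_)
    rw [mem_closedBall_zero_iff]
    rcases mem_diskWithArcs.1 hz with h | ⟨j, k, -, h⟩
    · exact h.trans (Real.one_le_exp zero_le_two)
    · rw [norm_of_mem_ringArc h, Real.exp_le_exp]
      linarith [ringLog_le_one j]
  have hsat := isSaturated_of_subset hDU
  set N := Ψ ⁻¹' (proj arcDomain '' Dᶜ) with hN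
  have hNo : IsOpen N := (hsat.isOpen_image_proj hDc.isOpen_compl).preimage hΨ
  have hinfN : OnePoint.infty ∈ N := by
    refine ⟨OnePoint.infty, ?_, ((hinf _).2 rfl).symm⟩
    rintro ⟨z, -, hz⟩
    exact OnePoint.coe_ne_infty z hz
  have hrange : (fun z : ℂ => (z : RiemannSphere)) '' (((↑) : ℂ → OnePoint ℂ) ⁻¹' Nᶜ) = Nᶜ := by
    refine image_preimage_eq_of_subset fun y hy => ?_
    rw [mem_range]
    exact OnePoint.ne_infty_iff_exists.1 fun h => hy (h ▸ hinfN)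
  refine ⟨((↑) : ℂ → OnePoint ℂ) ⁻¹' Nᶜ, ?_, fun z hz y hy => ?_⟩
  · refine (OnePoint.isClosed_image_coe.1 ?_).2
    exact hrange.symm ▸ hNo.isClosed_compl
  · rw [hrange]
    intro hyN
    rw [hN, mem_preimage, hy, hsat.proj_mem_image_iff] at hyN
    exact hyN ⟨z, mem_closedBall_zero_iff.2 hz, rfl⟩

/-- The images of the crosscuts at a suitable distance of a gap are short. -/
theorem exists_short_crosscut {g : ℂ → ℂ} {j k : ℕ} {A : ℝ} (hA : 0 ≤ A)
    (hg : DifferentiableOn ℂ g {z | (z : RiemannSphere) ∈ arcDomain} ∨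
      DifferentiableOn ℂ (fun z => starRingEnd ℂ (g z)) {z | (z : RiemannSphere) ∈ arcDomain})
    (hinj : InjOn g {z | (z : RiemannSphere) ∈ arcDomain})
    (hvol : volume (g '' (gapChart j k '' gapRect j)) ≤ ENNReal.ofReal A) :
    ∃ s ∈ Ioo (Real.log (gapWidth j)) (Real.log (bumpRadius j)),
      ∀ x ∈ g '' crosscut j k s, ∀ y ∈ g '' crosscut j k s,
        dist x y ≤ (Real.pi + A) / (2 * (j + 1) ^ 2) := by
  have hmaps : MapsTo (gapChart j k) (gapRect j) {z | (z : RiemannSphere) ∈ arcDomain} :=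
    fun w hw => gapChart_mem_arcDomain hw
  have hab : Real.log (gapWidth j) < Real.log (bumpRadius j) :=
    Real.log_lt_log (gapWidth_pos j) (gapWidth_lt_bumpRadius j)
  -- With width `(j + 1) ^ 4`, the choice `l = (j + 1)⁻²` makes both terms of the length-area bound
  -- of order `(j + 1)⁻²`.
  obtain ⟨s, hs, hsd⟩ := Complex.exists_vertical_segment_dist_le (G := g ∘ gapChart j k)
    (c := -(Real.pi / 2)) (d := Real.pi / 2) (l := 1 / ((j : ℝ) + 1) ^ 2)
    hab (by positivity) hA
    (hg.imp (fun h => h.comp (differentiable_gapChart j k).differentiableOn hmaps)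
      (fun h => h.comp (differentiable_gapChart j k).differentiableOn hmaps))
    (hinj.comp (injOn_gapChart j k) hmaps)
    (by rw [image_comp]; exact hvol)
  refine ⟨s, hs, ?_⟩
  rintro _ ⟨_, ⟨φ, hφ, rfl⟩, rfl⟩ _ ⟨_, ⟨φ', hφ', rfl⟩, rfl⟩
  refine (hsd φ hφ φ' hφ').trans (le_of_eq ?_)
  rw [log_bumpRadius_sub_log_gapWidth]
  have : (j : ℝ) + 1 ≠ 0 := by positivity
  field_simp
  ring

/-- Triangle inequality along `c 0, Q 0, c 1, Q 1, …`, where neighbours touch. The chain need not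
close up: only the distance to one point of `Q 0` matters. -/
theorem dist_le_of_chain {N : ℕ} {Q c : ℕ → Set ℂ} {r : ℕ → ℝ} {l : ℝ}
    (hQ : ∀ k < N, ∀ x ∈ Q k, ∀ y ∈ Q k, dist x y ≤ r k)
    (hc : ∀ k < N, ∀ x ∈ c k, ∀ y ∈ c k, dist x y ≤ l)
    (hcQ : ∀ k < N, (Q k ∩ closure (c k)).Nonempty)
    (hcQ' : ∀ k, k + 1 < N → (Q k ∩ closure (c (k + 1))).Nonempty) {b : ℂ} (hb : b ∈ Q 0)
    (hr : ∀ k < N, 0 ≤ r k) (hl : 0 ≤ l) {x : ℂ} (hx : ∃ k < N, x ∈ Q k ∨ x ∈ c k) :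
    dist x b ≤ ∑ k ∈ Finset.range N, (r k + l) := by
  have key : ∀ k < N, ∀ x, (x ∈ Q k ∨ x ∈ closure (c k)) →
      dist x b ≤ ∑ i ∈ Finset.range (k + 1), (r i + l) := by
    intro k
    induction k with
    | zero =>
      intro h0 x hx
      rw [Finset.sum_range_one]
      rcases hx with hx | hx
      · linarith [hQ 0 h0 x hx b hb]
      · obtain ⟨a, haQ, hac⟩ := hcQ 0 h0
        linarith [dist_triangle x a b, hQ 0 h0 a haQ b hb,
          Metric.dist_le_of_mem_closure (hc 0 h0) hx hac]
    | succ k ih =>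
      intro hk x hx
      obtain ⟨a, haQ, hac⟩ := hcQ' k hk
      have ha := ih (Nat.lt_of_succ_lt hk) a (Or.inl haQ)
      rw [Finset.sum_range_succ]
      rcases hx with hx | hx
      · obtain ⟨a', haQ', hac'⟩ := hcQ (k + 1) hk
        linarith [dist_triangle x a' b, dist_triangle a' a b, hQ (k + 1) hk x hx a' haQ',
          Metric.dist_le_of_mem_closure (hc (k + 1) hk) hac' hac]
      · linarith [dist_triangle x a b, hr (k + 1) hk,
          Metric.dist_le_of_mem_closure (hc (k + 1) hk) hx hac]
  obtain ⟨k, hk, hx⟩ := hx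
  refine (key k hk x (hx.imp_right fun h => subset_closure h)).trans ?_
  refine Finset.sum_le_sum_of_subset_of_nonneg (Finset.range_mono hk) fun i hi _ => ?_
  exact add_nonneg (hr i (Finset.mem_range.1 hi)) hl

/-- If the arcs of `arcDomain` correspond to round disks under a conformal map, then the unit disk
corresponds to a point. -/
theorem subsingleton_fiber_closedUnitDisk {Ψ : RiemannSphere → Hat arcDomain} (hΨ : Continuous Ψ)
    {g : ℂ → ℂ} (hgΨ : ∀ z : ℂ, (z : RiemannSphere) ∈ arcDomain →
      ∀ y, Ψ y = proj arcDomain z ↔ y = (g z : RiemannSphere))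
    (hg : DifferentiableOn ℂ g {z | (z : RiemannSphere) ∈ arcDomain} ∨
      DifferentiableOn ℂ (fun z => starRingEnd ℂ (g z)) {z | (z : RiemannSphere) ∈ arcDomain})
    (hinf : ∀ y, Ψ y = proj arcDomain OnePoint.infty ↔ y = OnePoint.infty)
    (hdisk : ∀ j k, k < j + 1 → ∃ (c : ℂ) (r : ℝ), 0 ≤ r ∧
      {y | ∃ x ∈ sphArc j k, Ψ y = proj arcDomain x} =
        (fun z : ℂ => (z : RiemannSphere)) '' Metric.closedBall c r) :
    {y | ∃ x ∈ closedUnitDisk, Ψ y = proj arcDomain x}.Subsingleton := by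
  have hT₂ := t2Space_hat isDomainSet_arcDomain
  choose! c r hr hQ using hdisk
  obtain ⟨K, hK, hKΨ⟩ := exists_compact_of_fiber hΨ hinf
  set A := (volume K).toReal with hA
  have hA0 : 0 ≤ A := ENNReal.toReal_nonneg
  have hgΨ' : ∀ z : ℂ, (z : RiemannSphere) ∈ arcDomain → Ψ (g z) = proj arcDomain z :=
    fun z hz => (hgΨ z hz _).2 rfl
  have hinj : InjOn g {z | (z : RiemannSphere) ∈ arcDomain} := by
    intro z hz w hw h
    have h1 := hgΨ' z hz
    rw [h, hgΨ' w hw] at h1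
    exact (OnePoint.coe_injective ((proj_eq_iff_of_mem (U := arcDomain) hw).1 h1)).symm
  have hmemQ : ∀ j k, k < j + 1 → ∀ a : ℂ, ∀ x ∈ sphArc j k, Ψ a = proj arcDomain x →
      a ∈ Metric.closedBall (c j k) (r j k) := by
    intro j k hk a x hx ha
    have : (a : RiemannSphere) ∈ {y | ∃ x ∈ sphArc j k, Ψ y = proj arcDomain x} := ⟨x, hx, ha⟩
    rwa [hQ j k hk, OnePoint.coe_injective.mem_set_image] at this
  have hQmem : ∀ j k, k < j + 1 → ∀ a ∈ Metric.closedBall (c j k) (r j k),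
      ∃ x ∈ sphArc j k, Ψ (a : RiemannSphere) = proj arcDomain x := by
    intro j k hk a ha
    have : (a : RiemannSphere) ∈ (fun z : ℂ => (z : RiemannSphere)) ''
      Metric.closedBall (c j k) (r j k) := ⟨a, ha, rfl⟩
    rwa [← hQ j k hk] at this
  have hsum : ∀ n, ∑ j ∈ Finset.range n, ∑ k ∈ Finset.range (j + 1), r j k ^ 2 ≤ A := by
    intro n
    rw [Finset.sum_sigma']
    refine sum_sq_radius_le _ (c := fun a : Σ _ : ℕ, ℕ => c a.1 a.2)
      (r := fun a : Σ _ : ℕ, ℕ => r a.1 a.2) ?_ ?_ hK ?_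
    · rintro ⟨j, k⟩ h
      simp only [Finset.mem_sigma, Finset.mem_range] at h
      exact hr j k h.2
    · rintro ⟨j, k⟩ h ⟨j', k'⟩ h' hne
      simp only [Finset.coe_sigma, mem_sigma_iff, Finset.mem_coe, Finset.mem_range] at h h'
      refine disjoint_left.2 fun a ha ha' => hne ?_
      obtain ⟨x, ⟨z, hz, rfl⟩, hax⟩ := hQmem j k h.2 a ha
      obtain ⟨x', hx', hax'⟩ := hQmem j' k' h'.2 a ha'
      have h1 := (proj_eq_iff_mem (sphArc_mem_complComponents h'.2) hx').1 (hax.symm.trans hax')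
      obtain ⟨z', hz', hzz⟩ := h1
      obtain rfl := OnePoint.coe_injective hzz
      have h2 := norm_of_mem_ringArc hz
      rw [norm_of_mem_ringArc hz'] at h2
      obtain rfl : j' = j := ringLog_strictAnti.injective (Real.exp_injective h2)
      by_contra hk
      exact disjoint_left.1 (disjoint_ringArc h.2 h'.2 fun h => hk (by rw [h])) hz hz'
    · rintro ⟨j, k⟩ h a ha
      simp only [Finset.mem_sigma, Finset.mem_range] at h
      obtain ⟨x, ⟨z, hz, rfl⟩, hax⟩ := hQmem j k h.2 a ha
      have := hKΨ z (by
        rw [norm_of_mem_ringArc hz, Real.exp_le_exp]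
        linarith [ringLog_le_one j]) a hax
      rwa [OnePoint.coe_injective.mem_set_image] at this
  have hvol : ∀ j k, volume (g '' (gapChart j k '' gapRect j)) ≤ ENNReal.ofReal A := by
    intro j k
    rw [hA, ENNReal.ofReal_toReal hK.measure_lt_top.ne]
    refine measure_mono ?_
    rintro _ ⟨_, ⟨w, hw, rfl⟩, rfl⟩
    have := hKΨ _ (norm_gapChart_le (k := k) hw) _ (hgΨ' _ (gapChart_mem_arcDomain hw))
    rwa [OnePoint.coe_injective.mem_set_image] at this
  have hdist : ∀ y₁ y₂ : ℂ, (∃ x ∈ closedUnitDisk, Ψ y₁ = proj arcDomain x) →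
      (∃ x ∈ closedUnitDisk, Ψ y₂ = proj arcDomain x) → ∀ j : ℕ,
      dist y₁ y₂ ≤ 4 * ∑ k ∈ Finset.range (j + 1), r j k + (Real.pi + A) / (j + 1) := by
    intro y₁ y₂ hy₁ hy₂ j
    set l := (Real.pi + A) / (2 * ((j : ℝ) + 1) ^ 2) with hl
    have hl0 : 0 ≤ l := by
      have := Real.pi_pos
      positivity
    choose s hs hsd using fun k => exists_short_crosscut hA0 hg hinj (hvol j k)
    -- At an endpoint of a crosscut `g` may have no limit, but `Ψ` is continuous. Any cluster point
    -- of the image curve therefore lies over the arc, that is, in the corresponding disk.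
    have htouch : ∀ k k' : ℕ, k < j + 1 → ∀ (F : Filter ℝ) [F.NeBot] (φ₀ : ℝ),
        (∀ᶠ φ in F, φ ∈ Ioo (-(Real.pi / 2)) (Real.pi / 2)) → F ≤ 𝓝 φ₀ →
        gapChart j k' (s k' + φ₀ * Complex.I) ∈ ringArc j k →
        (Metric.closedBall (c j k) (r j k) ∩ closure (g '' crosscut j k' (s k'))).Nonempty := by
      intro k k' hk F _ φ₀ hF hFle hmem
      obtain ⟨y, hy, hyΨ⟩ := exists_mem_closure_of_tendsto (F := F) hΨ
        (u := fun φ : ℝ => (g (gapChart j k' (s k' + φ * Complex.I)) : RiemannSphere))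
        (c := (fun z : ℂ => (z : RiemannSphere)) '' (g '' crosscut j k' (s k')))
        (y := proj arcDomain (gapChart j k' (s k' + φ₀ * Complex.I)))
        (by
          filter_upwards [hF] with φ hφ
          exact ⟨_, ⟨_, ⟨φ, hφ, rfl⟩, rfl⟩, rfl⟩)
        (by
          have h1 : Continuous fun φ : ℝ =>
              proj arcDomain (gapChart j k' (s k' + φ * Complex.I)) := by
            refine (continuous_proj _).comp (OnePoint.continuous_coe.comp ?_)
            exact (differentiable_gapChart j k').continuous.comp (by fun_prop)
          refine ((h1.tendsto φ₀).mono_left hFle).congr' ?_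
          filter_upwards [hF] with φ hφ
          exact (hgΨ' _ (gapChart_mem_arcDomain (add_mul_I_mem_gapRect (hs k') hφ))).symm)
      have hy' : y ∈ {y | ∃ x ∈ sphArc j k, Ψ y = proj arcDomain x} := ⟨_, ⟨_, hmem, rfl⟩, hyΨ⟩
      rw [hQ j k hk] at hy'
      obtain ⟨a, ha, rfl⟩ := hy'
      refine ⟨a, ha, ?_⟩
      rw [OnePoint.isOpenEmbedding_coe.isInducing.closure_eq_preimage_closure_image]
      exact hy
    have hpi2 : -(Real.pi / 2) < Real.pi / 2 := by linarith [Real.pi_pos]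
    set T := ∑ k ∈ Finset.range (j + 1), (2 * r j k + l) with hT
    set b := c j 0 with hb
    have hchain : ∀ x : ℂ, (∃ k < j + 1, x ∈ Metric.closedBall (c j k) (r j k) ∨
        x ∈ g '' crosscut j k (s k)) → dist x b ≤ T := by
      intro x hx
      refine dist_le_of_chain (Q := fun k => Metric.closedBall (c j k) (r j k))
        (c := fun k => g '' crosscut j k (s k)) ?_ (fun k _ => hsd k) ?_ ?_
        (Metric.mem_closedBall_self (hr j 0 (Nat.succ_pos j))) ?_ hl0 hx
      · intro k hk x hx y hy
        have := dist_triangle_right x y (c j k)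
        linarith [Metric.mem_closedBall.1 hx, Metric.mem_closedBall.1 hy]
      · intro k hk
        exact htouch k k hk (𝓝[<] (Real.pi / 2)) (Real.pi / 2) (Ioo_mem_nhdsLT hpi2)
          nhdsWithin_le_nhds (gapChart_pi_div_two_mem (hs k))
      · intro k hk
        exact htouch k (k + 1) (Nat.lt_of_succ_lt hk) (𝓝[>] (-(Real.pi / 2))) (-(Real.pi / 2))
          (Ioo_mem_nhdsGT hpi2) nhdsWithin_le_nhds (gapChart_neg_pi_div_two_mem (hs (k + 1)))
      · intro k hk
        linarith [hr j k hk]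
    have hT0 : 0 ≤ T := dist_nonneg.trans
      (hchain b ⟨0, Nat.succ_pos j, Or.inl (Metric.mem_closedBall_self (hr j 0 (Nat.succ_pos j)))⟩)
    obtain ⟨I, E, hI, hE, hIE, hIs, hEs, hdiskI, hinfE, hcover⟩ := exists_separation j s hs
    have hball : ∀ y : ℂ, (∃ x ∈ closedUnitDisk, Ψ y = proj arcDomain x) → dist y b ≤ T := by
      rintro y ⟨x, hx, hyx⟩
      by_contra hyT
      set C := ((fun z : ℂ => (z : RiemannSphere)) '' Metric.closedBall b T)ᶜ with hC
      have hyC : (y : RiemannSphere) ∈ C := by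
        rw [hC, mem_compl_iff, OnePoint.coe_injective.mem_set_image]
        exact hyT
      have hinfC : OnePoint.infty ∈ C := by
        rintro ⟨z, -, hz⟩
        exact OnePoint.coe_ne_infty z hz
      -- The exterior of the ball is connected and avoids the whole chain, so `Ψ` maps it into one
      -- side of the ring. It contains both `y`, on the inner side, and `∞`, on the outer side.
      have hpre := (isPreconnected_compl_image_closedBall (b := b) hT0).image Ψ hΨ.continuousOn
      have hdisj : Disjoint (proj arcDomain '' I) (proj arcDomain '' E) := by
        rw [disjoint_left]
        rintro _ ⟨v, hv, rfl⟩ hv'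
        rw [hEs.proj_mem_image_iff] at hv'
        exact disjoint_left.1 hIE hv hv'
      have hsub : Ψ '' C ⊆ proj arcDomain '' I ∪ proj arcDomain '' E := by
        rintro _ ⟨v, hv, rfl⟩
        obtain ⟨w, hw⟩ := surjective_proj arcDomain (Ψ v)
        rcases hcover w with h | h | ⟨k, hk, h⟩
        · exact Or.inl ⟨w, h, hw⟩
        · exact Or.inr ⟨w, h, hw⟩
        · exfalso
          have hv' : ∃ a : ℂ, v = a ∧ (a ∈ Metric.closedBall (c j k) (r j k) ∨
              a ∈ g '' crosscut j k (s k)) := by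
            rcases h with h | ⟨z, hz, rfl⟩
            · have : v ∈ {y | ∃ x ∈ sphArc j k, Ψ y = proj arcDomain x} := ⟨w, h, hw.symm⟩
              rw [hQ j k hk] at this
              obtain ⟨a, ha, rfl⟩ := this
              exact ⟨a, rfl, Or.inl ha⟩
            · have hzU : (z : RiemannSphere) ∈ arcDomain := by
                obtain ⟨φ, hφ, rfl⟩ := hz
                exact gapChart_mem_arcDomain (add_mul_I_mem_gapRect (hs k) hφ)
              exact ⟨g z, (hgΨ z hzU v).1 hw.symm, Or.inr ⟨z, hz, rfl⟩⟩
          obtain ⟨a, rfl, ha⟩ := hv'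
          exact hv ⟨a, Metric.mem_closedBall.2 (hchain a ⟨k, hk, ha⟩), rfl⟩
      have hall := hpre.subset_left_of_subset_union (hIs.isOpen_image_proj hI)
        (hEs.isOpen_image_proj hE) hdisj hsub ⟨Ψ y, ⟨y, hyC, rfl⟩, ⟨x, hdiskI hx, hyx.symm⟩⟩
      exact disjoint_left.1 hdisj (hall ⟨_, hinfC, rfl⟩)
        ⟨OnePoint.infty, hinfE, ((hinf _).2 rfl).symm⟩
    have h1 := dist_triangle_right y₁ y₂ b
    have h2 := hball y₁ hy₁
    have h3 := hball y₂ hy₂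
    have h4 : 2 * T = 4 * ∑ k ∈ Finset.range (j + 1), r j k + (Real.pi + A) / (j + 1) := by
      rw [hT, Finset.sum_add_distrib, ← Finset.mul_sum, Finset.sum_const, Finset.card_range,
        nsmul_eq_mul, hl]
      push_cast
      have : (j : ℝ) + 1 ≠ 0 := by positivity
      field_simp
      ring
    linarith
  have hcoe : ∀ y, (∃ x ∈ closedUnitDisk, Ψ y = proj arcDomain x) → y ≠ OnePoint.infty := by
    rintro y ⟨x, hx, hyx⟩ rfl
    rw [(hinf _).2 rfl, proj_eq_iff_of_mem infty_mem_arcDomain] at hyx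
    obtain ⟨z, -, hz⟩ := hx
    exact OnePoint.coe_ne_infty z (hz.trans hyx.symm)
  intro y₁ hy₁ y₂ hy₂
  have h₁ := hcoe y₁ hy₁
  have h₂ := hcoe y₂ hy₂
  lift y₁ to ℂ using h₁
  lift y₂ to ℂ using h₂
  by_contra hne
  have hd : 0 < dist y₁ y₂ := dist_pos.2 fun h => hne (congrArg _ h)
  exact not_exists_bound_of_ring_sums hd hsum (hdist y₁ y₂ hy₁ hy₂)

/-- Under the extension of a homeomorphism between domains, complementary components correspond
to complementary components. -/
theorem exists_component_of_extends {f : OpenPartialHomeomorph RiemannSphere RiemannSphere}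
    {F : Hat f.source ≃ₜ Hat f.target} (hF : Extends f F) {p : Set RiemannSphere}
    (hp : p ∈ complComponents f.source) :
    ∃ q ∈ complComponents f.target,
      ∀ y, y ∈ q ↔ ∃ x ∈ p, F.symm (proj f.target y) = proj f.source x := by
  obtain ⟨x, hx⟩ := nonempty_of_mem_complComponents hp
  obtain ⟨y, hy⟩ := surjective_proj f.target (F (proj f.source x))
  have hyD : y ∉ f.target := by
    intro h
    have h1 := hF _ (f.map_target h)
    rw [f.right_inv h, hy] at h1
    have h2 := (proj_eq_iff_of_mem (f.map_target h)).1 (F.injective h1)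
    exact subset_compl_of_mem_complComponents hp hx (h2 ▸ f.map_target h)
  have hq := mk_mem_complComponents hyD
  refine ⟨_, hq, fun v => ?_⟩
  have hyq : y ∈ connectedComponentIn f.targetᶜ y := mem_connectedComponentIn hyD
  rw [← proj_eq_iff_mem hq hyq, hy]
  constructor
  · intro h
    exact ⟨x, hx, by rw [h, F.symm_apply_apply]⟩
  · rintro ⟨x', hx', h⟩
    rw [F.symm_apply_eq] at h
    rw [h, proj_eq_of_mem hp hx' hx]

/-- The Möbius map with pole `f ∞` normalises the image so that `∞` corresponds to `∞`; closed disks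
avoiding the pole become Euclidean disks. -/
theorem exists_pointComponent {f : OpenPartialHomeomorph RiemannSphere RiemannSphere}
    (hf : f.source = arcDomain) (hconf : IsConformal f) (hD : IsCircleDomain f.target) :
    ∃ F : Hat f.source ≃ₜ Hat f.target, Extends f F ∧ ∃ q ∈ pointComponents f.target,
      F '' (proj f.source '' closedUnitDisk) = proj f.target '' q := by
  have hU : IsDomainSet f.source := hf ▸ isDomainSet_arcDomain
  obtain ⟨F, hF⟩ := exists_homeomorph_extends f hU hD.1
  refine ⟨F, hF, ?_⟩
  have hinfU : OnePoint.infty ∈ f.source := hf ▸ infty_mem_arcDomain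
  set a := f OnePoint.infty with ha
  have haD : a ∈ f.target := f.map_source hinfU
  set M := poleHomeo a with hM
  -- The inverse extension viewed from the normalised image sphere; the fibres of `Ψ` over component
  -- classes are the image components.
  obtain ⟨Ψ, hΨc, hΨ⟩ : ∃ Ψ : RiemannSphere → Hat arcDomain, Continuous Ψ ∧
      ∀ y x, Ψ y = proj arcDomain x ↔
        F.symm (proj f.target (M.symm y)) = proj f.source x := by
    rw [← hf]
    exact ⟨fun y => F.symm (proj f.target (M.symm y)),
      F.symm.continuous.comp ((continuous_proj _).comp M.symm.continuous), fun y x => Iff.rfl⟩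
  have hΨU : ∀ x ∈ f.source, ∀ y, Ψ y = proj arcDomain x ↔ y = M (f x) := by
    intro x hx y
    rw [hΨ, F.symm_apply_eq, hF x hx, eq_comm, proj_eq_iff_of_mem (f.map_source hx),
      eq_comm, M.symm_apply_eq]
  have hfa : ∀ z : ℂ, (z : RiemannSphere) ∈ f.source → f z ≠ a := fun z hz h =>
    OnePoint.coe_ne_infty z (f.injOn hz hinfU h)
  have hfib : ∀ p ∈ complComponents f.source, ∃ q ∈ complComponents f.target,
      {y | ∃ x ∈ p, Ψ y = proj arcDomain x} = M '' q ∧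
      F '' (proj f.source '' p) = proj f.target '' q := by
    intro p hp
    obtain ⟨q, hq, hqF⟩ := exists_component_of_extends hF hp
    refine ⟨q, hq, ?_, ?_⟩
    · ext y
      rw [M.image_eq_preimage_symm, mem_preimage, hqF]
      simp only [mem_ofPred_eq, hΨ]
    · ext v
      obtain ⟨y, rfl⟩ := surjective_proj f.target v
      constructor
      · rintro ⟨_, ⟨x, hx, rfl⟩, hv⟩
        refine ⟨y, (hqF y).2 ⟨x, hx, ?_⟩, rfl⟩
        rw [F.symm_apply_eq, hv]
      · rintro ⟨y', hy', hyy⟩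
        obtain ⟨x, hx, h⟩ := (hqF y').1 hy'
        refine ⟨_, ⟨x, hx, rfl⟩, ?_⟩
        rw [← hyy, ← h, F.apply_symm_apply]
  have hsub := subsingleton_fiber_closedUnitDisk hΨc
    (g := fun z : ℂ => poleCoord a (f z)) (fun z hz y => by
      rw [← hf] at hz
      rw [hΨU z hz, hM, poleHomeo_apply, poleMap_of_ne (hfa z hz)])
    (differentiableOn_poleCoord_comp hconf (fun z hz => hf ▸ hz) fun z hz =>
      hfa z (hf ▸ hz))
    (fun y => by rw [hΨU _ hinfU, ← ha, hM, poleHomeo_apply, poleMap_self])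
    (fun j k hk => by
      obtain ⟨q, hq, hqΨ, -⟩ := hfib _ (hf ▸ sphArc_mem_complComponents hk)
      have haq : a ∉ q := fun h => subset_compl_of_mem_complComponents hq h haD
      rw [hqΨ]
      by_cases hq0 : 0 < sphDiam q
      · exact image_poleMap_of_isClosedDisk (hD.2 q ⟨hq, hq0⟩) haq
      -- An arc may correspond to a point-component, which counts as a disk of radius `0`.
      · obtain ⟨x, hx⟩ := nonempty_of_mem_complComponents hq
        have hqx : q = {x} := (not_sphDiam_pos_iff.1 hq0).eq_singleton_of_mem hx
        have hxa : x ≠ a := fun h => haq (by rwa [← h])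
        refine ⟨poleCoord a x, 0, le_rfl, ?_⟩
        rw [hqx, Metric.closedBall_zero, image_singleton, image_singleton, hM, poleHomeo_apply,
          poleMap_of_ne hxa])
  obtain ⟨q, hq, hqΨ, hqF⟩ := hfib _ (hf ▸ closedUnitDisk_mem_complComponents)
  rw [hqΨ] at hsub
  exact ⟨q, ⟨hq, not_sphDiam_pos_iff.2 (subsingleton_of_image M.injective q hsub)⟩, hqF⟩

end

end RiemannSphere

theorem theorem1p3 (α : ℝ) (hα : 2 < α) :
    ∃ U : Set RiemannSphere,
      U ∈ RiemannSphere.ellDomains α ∧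
      RiemannSphere.closedUnitDisk ∈ RiemannSphere.nontrivialComponents U ∧
      (∀ p ∈ RiemannSphere.complComponents U, p ≠ RiemannSphere.closedUnitDisk →
        ∃ r : ℝ, 1 < r ∧ RiemannSphere.IsCircularArc r p) ∧
      ∀ f : OpenPartialHomeomorph RiemannSphere RiemannSphere,
        f.source = U → RiemannSphere.IsConformal f → RiemannSphere.IsCircleDomain f.target →
        ∃ F : RiemannSphere.Hat f.source ≃ₜ RiemannSphere.Hat f.target,
          RiemannSphere.Extends f F ∧
          ∃ q ∈ RiemannSphere.pointComponents f.target,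
            F '' (RiemannSphere.proj f.source '' RiemannSphere.closedUnitDisk) =
              RiemannSphere.proj f.target '' q := by
  refine ⟨RiemannSphere.arcDomain, RiemannSphere.arcDomain_mem_ellDomains hα,
    RiemannSphere.closedUnitDisk_mem_nontrivialComponents, ?_, ?_⟩
  · intro p hp hne
    obtain ⟨j, k, hk, rfl⟩ :=
      (RiemannSphere.eq_of_mem_complComponents_arcDomain hp).resolve_left hne
    exact ⟨_, Real.one_lt_exp_iff.2 (RiemannSphere.ringLog_pos j),
      RiemannSphere.isCircularArc_sphArc hk⟩
  · exact fun f hf hconf hD => RiemannSphere.exists_pointComponent hf hconf hD
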